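/- A \emph{semicomplete digraph} $\mathcal{H}$ is a finite digraph without loops in which any two distinct vertices $x,y$ are joined by at least one of the arcs $(x,y)$, $(y,x)$ (possibly both). A \emph{source} (\emph{sink}) is a vertex of in-degree (out-degree) zero. A \emph{cycle} is a directed cycle through pairwise distinct vertices, regarded as a subdigraph (so that rotations of a cycle are not distinguished; a pair of opposite arcs is a cycle of length $2$). A $k$-ary \emph{polymorphism} of $\mathcal{H}$ ($k\ge 1$) is a homomorphism from the direct power $\mathcal{H}^k$ to $\mathcal{H}$; it is \emph{idempotent} if $f(x,\ldots,x)=x$ for all vertices $x$. Let $\mathrm{id\mbox{-}Pol}(\mathcal{H})$ be the algebra on the vertex set of $\mathcal{H}$ whose operations are all idempotent polymorphisms of $\mathcal{H}$. For a finite algebra $\mathbb{A}$ let $f_{\mathbb{A}}(m)$ be the least cardinality of a generating set of the direct power $\mathbb{A}^m$, $m\ge 1$. The algebra $\mathbb{A}$ has the \emph{polynomially generated powers property} (PGP) if $f_{\mathbb{A}}=O(p)$ for some polynomial $p$, and the \emph{exponentially generated powers property} (EGP) if there is a constant $b>1$ such that $f_{\mathbb{A}}(m)=\Omega(b^m)$.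 \textbf{Theorem.} Let $\mathcal{H}$ be a semicomplete digraph. If $\mathcal{H}$ has at most one cycle, or has both a source and a sink, then $\mathrm{id\mbox{-}Pol}(\mathcal{H})$ has the PGP. Otherwise, $\mathrm{id\mbox{-}Pol}(\mathcal{H})$ has the EGP. -/

import Mathlib

open Filter Asymptotics

section Algebras

variable {A : Type*}

/-- A family of finitary operations on `A`: `F k` is the set of its `k`-ary basic operations.
The pair `(A, F)` is an algebra with domain `A`. -/
abbrev Operations (A : Type*) := ∀ k : ℕ, Set ((Fin k → A) → A)

/-- `S` is a subuniverse of the power `A ^ m`: it is closed under all the operations of the algebra,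
applied coordinatewise. -/
def IsSubuniverse (F : Operations A) (m : ℕ) (S : Set (Fin m → A)) : Prop :=
  ∀ (k : ℕ), ∀ f ∈ F k, ∀ t : Fin k → Fin m → A, (∀ i, t i ∈ S) → (fun j => f fun i => t i j) ∈ S

/-- `Γ` generates the power `A ^ m`: the only subuniverse that contains `Γ` is `A ^ m` itself. -/
def Generates (F : Operations A) (m : ℕ) (Γ : Set (Fin m → A)) : Prop :=
  ∀ S : Set (Fin m → A), IsSubuniverse F m S → Γ ⊆ S → S = Set.univ

/-- The growth function of the algebra: the least cardinality of a (finite) generating set of the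
power `A ^ m`. For finite `A` the whole power is such a set. -/
noncomputable def growth (F : Operations A) (m : ℕ) : ℕ :=
  sInf {n | ∃ Γ : Finset (Fin m → A), Γ.card = n ∧ Generates F m (Γ : Set (Fin m → A))}

/-- The polynomially generated powers property: the growth function is `O(p)` for some
polynomial `p`. -/
def HasPGP (F : Operations A) : Prop :=
  ∃ p : Polynomial ℝ, (fun m : ℕ => (growth F m : ℝ)) =O[atTop] fun m : ℕ => p.eval (m : ℝ)

/-- The exponentially generated powers property: the growth function is `Ω(b ^ m)` for some
constant `b > 1`. -/
def HasEGP (F : Operations A) : Prop :=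
  ∃ b : ℝ, 1 < b ∧ (fun m : ℕ => b ^ m) =O[atTop] fun m : ℕ => (growth F m : ℝ)

end Algebras

namespace Digraph

variable {V : Type*}

/-- `f` is a `k`-ary polymorphism of `H`: a homomorphism from the `k`-th direct power of `H`
to `H`. -/
def IsPolymorphism (H : Digraph V) {k : ℕ} (f : (Fin k → V) → V) : Prop :=
  ∀ x y : Fin k → V, (∀ i, H.Adj (x i) (y i)) → H.Adj (f x) (f y)

/-- The algebra of the idempotent polymorphisms of `H`, of all arities `k ≥ 1`. -/
def idPol (H : Digraph V) : Operations V := fun k =>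
  {f | 0 < k ∧ H.IsPolymorphism f ∧ ∀ x : V, f (fun _ => x) = x}

/-- Irreflexive, and any two distinct vertices are joined by an arc in at least one direction. -/
def IsSemicomplete (H : Digraph V) : Prop :=
  (∀ x, ¬ H.Adj x x) ∧ ∀ x y, x ≠ y → H.Adj x y ∨ H.Adj y x

/-- A vertex of in-degree zero. -/
def IsSource (H : Digraph V) (s : V) : Prop := ∀ x, ¬ H.Adj x s

/-- A vertex of out-degree zero. -/
def IsSink (H : Digraph V) (t : V) : Prop := ∀ x, ¬ H.Adj t x

/-- `C` is the arc set of a directed cycle of `H`: there are pairwise distinct vertices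
`c 0, …, c n` with arcs `c 0 → c 1 → ⋯ → c n → c 0` in `H`, and `C` consists of these arcs
(the index `i + 1` is read modulo `n + 1`). Taking arc sets identifies a cycle with
its rotations. -/
def IsCycle (H : Digraph V) (C : Set (V × V)) : Prop :=
  ∃ (n : ℕ) (c : Fin (n + 1) → V), Function.Injective c ∧
    (∀ i, H.Adj (c i) (c (i + 1))) ∧ C = Set.range fun i => (c i, c (i + 1))

/-- `H` has at most one directed cycle. -/
def HasAtMostOneCycle (H : Digraph V) : Prop :=
  ∀ C D : Set (V × V), H.IsCycle C → H.IsCycle D → C = D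

end Digraph

/-!
The idempotent polymorphisms of a strong semicomplete digraph with a transitive triple
`x → z → y`, `x → y` are the projections. For binary `s` the starting point is that `s a b` lies in
`{a, b}` or strictly between `a` and `b`. Hence `s` maps some arc to one of its ends
(`Digraph.IsBinPol.exists_eq_fst_or_snd`), this spreads to an arc at each vertex
(`Digraph.exists_adj_forall_eq_snd`), and then to all arcs, by a pursuit along a walk that finally
has to meet itself (`Digraph.IsBinPol.eq_fst_of_adj`). In higher arity some variable `i` decides on
all tuples that are constant off `i`, since there is no majority polymorphism; and the triple makes
the digraph primitive, which allows one to trace any tuple back to such a tuple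
(`Digraph.IsPol.exists_eq_proj`). The strong semicomplete digraphs with at least two vertices and no
transitive triple are the cycles of length two and three.

Passing to the opposite digraph, which has the same polymorphisms, one may assume that there is no
source, unless there are both a source and a sink. The initial strong component `C` is then
nontrivial, dominates everything else, and is preserved by the idempotent polymorphisms.

*Exponential growth.* All idempotent polymorphisms are projections on `C`: if `C` has a transitive
triple, by the above; if `C` is a cycle but there is another one, because the polymorphism would
otherwise act on the closest other nontrivial component as both binary projections
(`Digraph.exists_eq_proj_of_not_hasTransitiveTriple`). As `C` dominates every vertex, the value of
a polymorphism at `x` has all the in-neighbours in `C` that `x i` has, for some `i`. This yields two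
disjoint sets of vertices such that a value in one of them requires `x i` to be in it, and a
generating set of the `m`-th power has to meet all the `2 ^ m` boxes with sides in these sets
(`Digraph.hasEGP_of_proj`).

*Polynomial growth.* A bounded number of tuples, together with one tuple for each coordinate,
generates the power. With a source and a sink the columns of this family of tuples can be isolated
vertices of a power of `H`, so that polymorphisms take arbitrary values there
(`Digraph.hasPGP_of_source_of_sink`). If `C` is the only cycle, the columns can be chosen in disjoint
orbits of a power of `C` (with a sink appended, if there are vertices outside of `C`), on each of
which a polymorphism may be prescribed freely (`Digraph.exists_isPol_column`).
-/

/-! ### Digraphs, their opposites, and walks -/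

namespace Digraph

variable {V : Type*} {H : Digraph V}

/-- The digraph with all arcs reversed. -/
def op (H : Digraph V) : Digraph V := ⟨fun a b => H.Adj b a⟩

@[simp] lemma op_adj {a b : V} : H.op.Adj a b ↔ H.Adj b a := Iff.rfl

lemma IsSemicomplete.op (hH : H.IsSemicomplete) : H.op.IsSemicomplete :=
  ⟨fun x => hH.1 x, fun x y h => (hH.2 x y h).symm⟩

lemma IsSemicomplete.ne_of_adj (hH : H.IsSemicomplete) {a b : V} (h : H.Adj a b) : a ≠ b := by
  rintro rfl
  exact hH.1 a h

lemma IsSemicomplete.adj_of_not (hH : H.IsSemicomplete) {a b : V} (hab : a ≠ b)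
    (h : ¬ H.Adj a b) : H.Adj b a :=
  (hH.2 a b hab).resolve_left h

/-- Every vertex is reachable from every other. -/
def IsStrong (H : Digraph V) : Prop := ∀ a b, Relation.ReflTransGen H.Adj a b

lemma IsStrong.op (h : H.IsStrong) : H.op.IsStrong := fun a b =>
  (Relation.reflTransGen_swap (r := H.Adj)).2 (h b a)

/-- Some arc `x → y` is accompanied by a path `x → z → y`. Among strong semicomplete digraphs on at
least two vertices only the cycles of length `2` and `3` have no such triple. -/
def HasTransitiveTriple (H : Digraph V) : Prop := ∃ x y z, H.Adj x y ∧ H.Adj x z ∧ H.Adj z y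

lemma HasTransitiveTriple.op (h : H.HasTransitiveTriple) : H.op.HasTransitiveTriple := by
  obtain ⟨x, y, z, h1, h2, h3⟩ := h
  exact ⟨y, x, z, h1, h3, h2⟩

lemma HasTransitiveTriple.of_adj_adj (hH : H.IsSemicomplete) {v a b : V} (hab : a ≠ b)
    (ha : H.Adj v a) (hb : H.Adj v b) : H.HasTransitiveTriple := by
  rcases hH.2 a b hab with h | h
  · exact ⟨v, b, a, hb, ha, h⟩
  · exact ⟨v, a, b, ha, hb, h⟩

/-- There is a walk of length `n` from `a` to `b`. -/
def Walk (H : Digraph V) : ℕ → V → V → Prop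
  | 0, a, b => a = b
  | n + 1, a, b => ∃ c, H.Adj a c ∧ Walk H n c b

lemma Walk.trans {m n : ℕ} {a b c : V} (h : H.Walk m a b) (h' : H.Walk n b c) :
    H.Walk (m + n) a c := by
  induction m generalizing a with
  | zero => cases h; simpa using h'
  | succ m ih =>
    obtain ⟨d, hd, h⟩ := h
    rw [Nat.succ_add]
    exact ⟨d, hd, ih h⟩

lemma Walk.single {a b : V} (h : H.Adj a b) : H.Walk 1 a b := ⟨b, h, rfl⟩

lemma walk_succ' {n : ℕ} {a b : V} : H.Walk (n + 1) a b ↔ ∃ c, H.Walk n a c ∧ H.Adj c b := by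
  constructor
  · intro h
    induction n generalizing a with
    | zero =>
      obtain ⟨c, hc, rfl⟩ := h
      exact ⟨a, rfl, hc⟩
    | succ n ih =>
      obtain ⟨c, hc, h⟩ := h
      obtain ⟨d, hd, h⟩ := ih h
      exact ⟨d, ⟨c, hc, hd⟩, h⟩
  · rintro ⟨c, hc, h⟩
    exact hc.trans (Walk.single h)

lemma exists_walk {a b : V} (h : Relation.ReflTransGen H.Adj a b) : ∃ n, H.Walk n a b := by
  induction h with
  | refl => exact ⟨0, rfl⟩
  | tail _ hbc ih =>
    obtain ⟨n, hn⟩ := ih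
    exact ⟨n + 1, hn.trans (Walk.single hbc)⟩

lemma Walk.reflTransGen {n : ℕ} {a b : V} (h : H.Walk n a b) :
    Relation.ReflTransGen H.Adj a b := by
  induction n generalizing a with
  | zero => cases h; exact .refl
  | succ n ih =>
    obtain ⟨c, hc, h⟩ := h
    exact .head hc (ih h)

lemma Walk.exists_seq {n : ℕ} {a b : V} (h : H.Walk n a b) :
    ∃ c : ℕ → V, c 0 = a ∧ c n = b ∧ ∀ i < n, H.Adj (c i) (c (i + 1)) := by
  induction n generalizing a with
  | zero => exact ⟨fun _ => a, rfl, h, by simp⟩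
  | succ n ih =>
    obtain ⟨d, had, h⟩ := h
    obtain ⟨c, h0, hn, hc⟩ := ih h
    refine ⟨fun i => Nat.casesOn i a c, rfl, hn, fun i hi => ?_⟩
    cases i with
    | zero => simpa [h0] using had
    | succ i => exact hc i (by omega)

lemma Walk.of_forall_adj {r : ℕ → V} (h : ∀ n, H.Adj (r n) (r (n + 1))) (m n : ℕ) :
    H.Walk n (r m) (r (m + n)) := by
  induction n with
  | zero => rfl
  | succ n ih => exact walk_succ'.2 ⟨_, ih, h _⟩

lemma Walk.mul {n : ℕ} {a : V} (h : H.Walk n a a) (q : ℕ) : H.Walk (q * n) a a := by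
  induction q with
  | zero => simp [Walk]
  | succ q ih => rw [Nat.succ_mul]; exact ih.trans h

/-- A strong digraph with a transitive triple is primitive: the triple yields closed walks of two
consecutive lengths. -/
lemma exists_walk_length [Finite V] (hs : H.IsStrong) (ht : H.HasTransitiveTriple) :
    ∃ (e : V) (t : ℕ), ∀ u, H.Walk t e u := by
  obtain ⟨x, y, z, hxy, hxz, hzy⟩ := ht
  obtain ⟨m, hm⟩ := exists_walk (hs y x)
  have h1 : H.Walk (m + 1) x x := ⟨y, hxy, hm⟩
  have h2 : H.Walk (m + 2) x x := ⟨z, hxz, y, hzy, hm⟩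
  have hclosed : ∀ n, (m + 1) * (m + 1) ≤ n → H.Walk n x x := by
    intro n hn
    have hq : m + 1 ≤ n / (m + 1) := (Nat.le_div_iff_mul_le (Nat.succ_pos m)).2 hn
    have hr : n % (m + 1) < m + 1 := Nat.mod_lt _ (Nat.succ_pos m)
    have hle : n % (m + 1) ≤ n / (m + 1) := by omega
    have := (h1.mul (n / (m + 1) - n % (m + 1))).trans (h2.mul (n % (m + 1)))
    convert this using 1
    obtain ⟨k, hk⟩ := Nat.exists_eq_add_of_le hle
    have hdm := Nat.div_add_mod n (m + 1)
    rw [hk] at hdm ⊢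
    rw [Nat.add_sub_cancel_left]
    nlinarith
  choose d hd using fun u => exists_walk (hs x u)
  obtain ⟨D, hD⟩ := (Set.finite_range d).bddAbove
  refine ⟨x, (m + 1) * (m + 1) + D, fun u => ?_⟩
  have hle : d u ≤ D := hD ⟨u, rfl⟩
  have := (hclosed ((m + 1) * (m + 1) + (D - d u)) (by omega)).trans (hd u)
  convert this using 1
  omega

/-! ### Binary idempotent polymorphisms -/

/-- `s` is an idempotent polymorphism of `H` in two variables. -/
structure IsBinPol (H : Digraph V) (s : V → V → V) : Prop where
  map : ∀ {x x' y y'}, H.Adj x x' → H.Adj y y' → H.Adj (s x y) (s x' y')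
  idem : ∀ x, s x x = x

namespace IsBinPol

variable {s t u : V → V → V}

lemma fst : H.IsBinPol (fun x _ => x) := ⟨fun h _ => h, fun _ => rfl⟩

lemma snd : H.IsBinPol (fun _ y => y) := ⟨fun _ h => h, fun _ => rfl⟩

lemma swap (hs : H.IsBinPol s) : H.IsBinPol (fun x y => s y x) :=
  ⟨fun h h' => hs.map h' h, hs.idem⟩

lemma op (hs : H.IsBinPol s) : H.op.IsBinPol s :=
  ⟨fun h h' => hs.map (H := H) h h', hs.idem⟩

lemma comp (hs : H.IsBinPol s) (ht : H.IsBinPol t) (hu : H.IsBinPol u) :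
    H.IsBinPol (fun x y => s (t x y) (u x y)) :=
  ⟨fun h h' => hs.map (ht.map h h') (hu.map h h'), fun x => by simp [hs.idem, ht.idem, hu.idem]⟩

lemma adj_of_adj (hs : H.IsBinPol s) {u a b : V} (ha : H.Adj u a) (hb : H.Adj u b) :
    H.Adj u (s a b) := by
  have := hs.map ha hb
  rwa [hs.idem] at this

lemma adj_of_adj' (hs : H.IsBinPol s) {u a b : V} (ha : H.Adj a u) (hb : H.Adj b u) :
    H.Adj (s a b) u := by
  have := hs.map ha hb
  rwa [hs.idem] at this

end IsBinPol

/-- `a → w → b`, with neither of these arcs reversible. -/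
def StrictBetween (H : Digraph V) (a w b : V) : Prop :=
  H.Adj a w ∧ H.Adj w b ∧ ¬ H.Adj w a ∧ ¬ H.Adj b w

/-- A value of `s a b` outside `{a, b}` can neither dominate nor be dominated by both `a`
and `b`. -/
lemma IsBinPol.strictBetween {s : V → V → V} (hH : H.IsSemicomplete) (hs : H.IsBinPol s) {a b : V}
    (h1 : s a b ≠ a) (h2 : s a b ≠ b) :
    H.StrictBetween a (s a b) b ∨ H.StrictBetween b (s a b) a := by
  have hin : ¬ (H.Adj a (s a b) ∧ H.Adj b (s a b)) := fun h => hH.1 _ (hs.adj_of_adj' h.1 h.2)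
  have hout : ¬ (H.Adj (s a b) a ∧ H.Adj (s a b) b) := fun h => hH.1 _ (hs.adj_of_adj h.1 h.2)
  have ha := hH.2 _ _ h1
  have hb := hH.2 _ _ h2
  unfold StrictBetween
  tauto

/-- The values `s a b` of the binary idempotent polymorphisms: the subuniverse generated
by `a` and `b`. -/
def binSpan (H : Digraph V) (a b : V) : Set V := {w | ∃ s, H.IsBinPol s ∧ s a b = w}

lemma left_mem_binSpan (a b : V) : a ∈ H.binSpan a b := ⟨_, IsBinPol.fst, rfl⟩

lemma right_mem_binSpan (a b : V) : b ∈ H.binSpan a b := ⟨_, IsBinPol.snd, rfl⟩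

lemma binSpan_subset {a b c d : V} (hc : c ∈ H.binSpan a b) (hd : d ∈ H.binSpan a b) :
    H.binSpan c d ⊆ H.binSpan a b := by
  obtain ⟨t, ht, rfl⟩ := hc
  obtain ⟨u, hu, rfl⟩ := hd
  rintro _ ⟨s, hs, rfl⟩
  exact ⟨_, hs.comp ht hu, rfl⟩

lemma strictBetween_of_mem_binSpan (hH : H.IsSemicomplete) {a b w : V} (hw : w ∈ H.binSpan a b)
    (h1 : w ≠ a) (h2 : w ≠ b) : H.StrictBetween a w b ∨ H.StrictBetween b w a := by
  obtain ⟨s, hs, rfl⟩ := hw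
  exact hs.strictBetween hH h1 h2

/-- If `s` maps an arc `a → w` to its head, then `s` maps every arc `w → d` into the
out-neighbourhood of `w`. -/
lemma IsBinPol.adj_of_eq_snd {s : V → V → V} (hs : H.IsBinPol s) {a w d : V} (haw : H.Adj a w)
    (h : s a w = w) (hwd : H.Adj w d) : H.Adj w (s w d) := by
  simpa [h] using hs.map haw hwd

lemma IsBinPol.adj_of_eq_fst {s : V → V → V} (hs : H.IsBinPol s) {a w d : V} (haw : H.Adj w a)
    (h : s w a = w) (hdw : H.Adj d w) : H.Adj (s d w) w := by
  simpa [h] using hs.map hdw haw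

/-- Acting as the second projection on one arc spreads: for any arc `a₀ → w₀` of a strong semicomplete
digraph every vertex `v` is the head of an arc `z → v` such that all the operations with value `w₀`
at `(a₀, w₀)` have value `v` at `(z, v)`. -/
lemma exists_adj_forall_eq_snd [Finite V] (hH : H.IsSemicomplete) (hst : H.IsStrong) {a₀ w₀ : V}
    (h₀ : H.Adj a₀ w₀) (v : V) :
    ∃ z, H.Adj z v ∧ ∀ s, H.IsBinPol s → s a₀ w₀ = w₀ → s z v = v := by
  classical
  set P : V → Prop := fun v => ∃ z, H.Adj z v ∧ ∀ s, H.IsBinPol s → s a₀ w₀ = w₀ → s z v = v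
    with hP
  -- the subuniverse generated by `z` and `d` using only the operations in question
  set E : V → V → Set V := fun z d => {e | ∃ s, H.IsBinPol s ∧ s a₀ w₀ = w₀ ∧ s z d = e} with hE
  have hself : ∀ z d, d ∈ E z d := fun z d => ⟨_, IsBinPol.snd, rfl, rfl⟩
  -- composition in the second argument
  have hL : ∀ {z d e}, e ∈ E z d → E z e ⊆ E z d := by
    rintro z d _ ⟨s, hs, hs0, rfl⟩ _ ⟨t, ht, ht0, rfl⟩
    exact ⟨_, ht.comp IsBinPol.fst hs, by simp [hs0, ht0], rfl⟩
  -- composition in the first argument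
  have hR : ∀ {z d e}, e ∈ E z d → E e d ⊆ E z d := by
    rintro z d _ ⟨s, hs, hs0, rfl⟩ _ ⟨t, ht, ht0, rfl⟩
    exact ⟨_, ht.comp hs IsBinPol.snd, by simp [hs0, ht.idem], rfl⟩
  have hout : ∀ {w d e}, P w → H.Adj w d → e ∈ E w d → H.Adj w e := by
    rintro w d _ ⟨z, hz, hf⟩ hwd ⟨s, hs, hs0, rfl⟩
    exact hs.adj_of_eq_snd hz (hf s hs hs0) hwd
  have hbtw : ∀ {w d e}, P w → H.Adj w d → e ∈ E w d → e ≠ d → H.StrictBetween w e d := by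
    intro w d e hw hwd he hed
    have hwe := hout hw hwd he
    obtain ⟨s, hs, hs0, rfl⟩ := he
    rcases hs.strictBetween hH (hH.ne_of_adj hwe).symm hed with h | h
    · exact h
    · exact absurd hwe h.2.2.2
  have hmin : ∀ n, ∀ w d, P w → H.Adj w d → (E w d).ncard = n →
      ∃ e ∈ E w d, E w e = {e} := by
    intro n
    induction n using Nat.strong_induction_on with
    | _ n ih =>
      intro w d hw hwd hn
      by_cases hsing : E w d = {d}
      · exact ⟨d, hself w d, hsing⟩
      · obtain ⟨e, he, hed⟩ : ∃ e ∈ E w d, e ≠ d := by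
          by_contra! hcon
          exact hsing (Set.eq_singleton_iff_unique_mem.2 ⟨hself w d, hcon⟩)
        have hb := hbtw hw hwd he hed
        have hlt : (E w e).ncard < n := by
          rw [← hn]
          refine Set.ncard_lt_ncard ⟨hL he, fun hsub => ?_⟩
          have hb' := hbtw hw hb.1 (hsub (hself w d)) hed.symm
          exact hb.2.2.2 hb'.2.1
        obtain ⟨f, hf, hf'⟩ := ih _ hlt w e hw hb.1 rfl
        exact ⟨f, hL he hf, hf'⟩
  have hfix : ∀ {w e}, H.Adj w e → E w e = {e} → P e := by
    intro w e hwe h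
    refine ⟨w, hwe, fun s hs hs0 => ?_⟩
    have : s w e ∈ E w e := ⟨s, hs, hs0, rfl⟩
    rw [h] at this
    exact this
  have hstep : ∀ n, ∀ w d, P w → H.Adj w d → (E w d).ncard = n → P d := by
    intro n
    induction n using Nat.strong_induction_on with
    | _ n ih =>
      intro w d hw hwd hn
      by_cases hsing : E w d = {d}
      · exact hfix hwd hsing
      · obtain ⟨e₀, he₀, hed₀⟩ : ∃ e ∈ E w d, e ≠ d := by
          by_contra! hcon
          exact hsing (Set.eq_singleton_iff_unique_mem.2 ⟨hself w d, hcon⟩)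
        have hb₀ := hbtw hw hwd he₀ hed₀
        obtain ⟨e, he, he'⟩ := hmin _ w e₀ hw hb₀.1 rfl
        have hed : e ≠ d := by
          rintro rfl
          exact hb₀.2.2.2 (hbtw hw hb₀.1 he hed₀.symm).2.1
        have heE := hL he₀ he
        have hb := hbtw hw hwd heE hed
        have hPe := hfix hb.1 he'
        refine ih _ ?_ e d hPe hb.2.1 rfl
        rw [← hn]
        refine Set.ncard_lt_ncard ⟨hR heE, fun hsub => ?_⟩
        exact hH.1 e (hout hPe hb.2.1 (hsub heE))
  have hP0 : P w₀ := ⟨a₀, h₀, fun s _ h => h⟩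
  have : ∀ v, Relation.ReflTransGen H.Adj w₀ v → P v := by
    intro v hv
    induction hv with
    | refl => exact hP0
    | tail _ hbc ih => exact hstep _ _ _ ih hbc rfl
  exact this v (hst w₀ v)

lemma IsBinPol.forall_exists_eq_snd [Finite V] {s : V → V → V} (hH : H.IsSemicomplete)
    (hst : H.IsStrong) (hs : H.IsBinPol s) {x y : V} (hxy : H.Adj x y) (h : s x y = y) (v : V) :
    ∃ z, H.Adj z v ∧ s z v = v := by
  obtain ⟨z, hz, hz'⟩ := exists_adj_forall_eq_snd hH hst hxy v
  exact ⟨z, hz, hz' s hs h⟩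

lemma IsBinPol.forall_exists_eq_fst [Finite V] {s : V → V → V} (hH : H.IsSemicomplete)
    (hst : H.IsStrong) (hs : H.IsBinPol s) {x y : V} (hxy : H.Adj x y) (h : s x y = x) (v : V) :
    ∃ z, H.Adj v z ∧ s v z = v :=
  hs.op.swap.forall_exists_eq_snd hH.op hst.op (x := y) (y := x) hxy h v

/-! ### Operations without a fixed arc -/

lemma fin_three_cases : ∀ i j : Fin 3, j = i ∨ j = i + 1 ∨ j = i + 2 := by decide

/-- Three vertices on a cycle `c 0 → c 1 → c 2 → c 0` on which `g` acts by
`g (c i) (c (i + 1)) = c (i + 2)`. -/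
structure IsRotor (H : Digraph V) (g : V → V → V) (c : Fin 3 → V) : Prop where
  adj : ∀ i, H.Adj (c i) (c (i + 1))
  apply : ∀ i, g (c i) (c (i + 1)) = c (i + 2)

namespace IsRotor

variable {g : V → V → V} {c : Fin 3 → V}

/-- A vertex that dominates two vertices of a rotor dominates it. -/
lemma adj_of_adj_adj (hc : H.IsRotor g c) (hg : H.IsBinPol g) {u : V} {i : Fin 3}
    (h1 : H.Adj u (c i)) (h2 : H.Adj u (c (i + 1))) (j : Fin 3) : H.Adj u (c j) := by
  have h3 : H.Adj u (c (i + 2)) := hc.apply i ▸ hg.adj_of_adj h1 h2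
  rcases fin_three_cases i j with rfl | rfl | rfl <;> assumption

lemma adj_of_adj_adj' (hc : H.IsRotor g c) (hg : H.IsBinPol g) {u : V} {i : Fin 3}
    (h1 : H.Adj (c i) u) (h2 : H.Adj (c (i + 1)) u) (j : Fin 3) : H.Adj (c j) u := by
  have h3 : H.Adj (c (i + 2)) u := hc.apply i ▸ hg.adj_of_adj' h1 h2
  rcases fin_three_cases i j with rfl | rfl | rfl <;> assumption

lemma op (hc : H.IsRotor g c) : H.op.IsRotor (fun x y => g y x) (fun i => c (-i)) := by
  constructor
  · intro i
    have := hc.adj (-(i + 1))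
    rwa [show ∀ i : Fin 3, -(i + 1) + 1 = -i by decide] at this
  · intro i
    have := hc.apply (-(i + 1))
    rw [show ∀ i : Fin 3, -(i + 1) + 1 = -i by decide] at this
    rw [this]
    exact congrArg c ((show ∀ i : Fin 3, -(i + 1) + 2 = -(i + 2) by decide) i)

/-- Each vertex outside a rotor dominates the whole rotor or is dominated by it. -/
lemma dichotomy (hH : H.IsSemicomplete) (hc : H.IsRotor g c) (hg : H.IsBinPol g) {u : V}
    (hu : ∀ i, u ≠ c i) : (∀ i, H.Adj u (c i)) ∨ (∀ i, H.Adj (c i) u) := by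
  have h0 := hH.2 _ _ (hu 0)
  have h1 := hH.2 _ _ (hu 1)
  have h2 := hH.2 _ _ (hu 2)
  rcases h0 with h0 | h0 <;> rcases h1 with h1 | h1 <;> rcases h2 with h2 | h2
  all_goals first
    | exact Or.inl (hc.adj_of_adj_adj hg (i := 0) h0 h1)
    | exact Or.inl (hc.adj_of_adj_adj hg (i := 1) h1 h2)
    | exact Or.inl (hc.adj_of_adj_adj hg (i := 2) h2 h0)
    | exact Or.inr (hc.adj_of_adj_adj' hg (i := 0) h0 h1)
    | exact Or.inr (hc.adj_of_adj_adj' hg (i := 1) h1 h2)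
    | exact Or.inr (hc.adj_of_adj_adj' hg (i := 2) h2 h0)

end IsRotor

/-- If `g` maps no arc to one of its ends, then an arc inside `S` that spans a smallest subuniverse
spans a rotor, and the cycle of that rotor has no reversible arcs. -/
lemma exists_isRotor [Finite V] (hH : H.IsSemicomplete) {g : V → V → V} (hg : H.IsBinPol g)
    (h0 : ∀ x y, H.Adj x y → g x y ≠ x ∧ g x y ≠ y) {S : Set V}
    (hS : ∀ p ∈ S, ∀ q ∈ S, H.binSpan p q ⊆ S) {a b : V} (ha : a ∈ S) (hb : b ∈ S)
    (hab : H.Adj a b) :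
    ∃ c : Fin 3 → V, H.IsRotor g c ∧ (∀ i, c i ∈ S) ∧ ∀ i, ¬ H.Adj (c (i + 1)) (c i) := by
  classical
  obtain ⟨⟨p, q⟩, ⟨hp, hq, hpq⟩, hmin⟩ := Set.exists_min_image
    {e : V × V | e.1 ∈ S ∧ e.2 ∈ S ∧ H.Adj e.1 e.2} (fun e => (H.binSpan e.1 e.2).ncard)
    (Set.toFinite _) ⟨(a, b), ha, hb, hab⟩
  replace hmin : ∀ x y, x ∈ S → y ∈ S → H.Adj x y →
      (H.binSpan p q).ncard ≤ (H.binSpan x y).ncard := fun x y hx hy hxy => hmin (x, y) ⟨hx, hy, hxy⟩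
  have hsub := hS p hp q hq
  have heq : ∀ {x y}, x ∈ H.binSpan p q → y ∈ H.binSpan p q → H.Adj x y →
      H.binSpan x y = H.binSpan p q := fun hx hy hxy =>
    Set.eq_of_subset_of_ncard_le (binSpan_subset hx hy) (hmin _ _ (hsub hx) (hsub hy) hxy)
  have hpm : p ∈ H.binSpan p q := left_mem_binSpan p q
  have hqm : q ∈ H.binSpan p q := right_mem_binSpan p q
  -- the generators of a smallest subuniverse cannot dominate each other through a third element
  have htype : ∀ {a b x}, a ∈ H.binSpan p q → b ∈ H.binSpan p q → H.Adj a b →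
      x ∈ H.binSpan p q → x ≠ a → x ≠ b → H.StrictBetween b x a := by
    intro a b x ha hb hab hx hxa hxb
    rcases strictBetween_of_mem_binSpan hH ((heq ha hb hab).symm ▸ hx) hxa hxb with h | h
    · exfalso
      have hb' : b ∈ H.binSpan a x := by rw [heq ha hx h.1]; exact hb
      rcases strictBetween_of_mem_binSpan hH hb' (hH.ne_of_adj hab).symm hxb.symm with h' | h'
      · exact h'.2.2.2 h.2.1
      · exact h'.2.2.2 hab
    · exact h
  have huniq : ∀ {x x'}, x ∈ H.binSpan p q → x' ∈ H.binSpan p q → x ≠ p → x ≠ q → x' ≠ p →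
      x' ≠ q → x = x' := by
    intro x x' hx hx' h1 h2 h3 h4
    by_contra hne
    have hx1 := htype hpm hqm hpq hx h1 h2
    have hx2 := htype hpm hqm hpq hx' h3 h4
    have hx3 := htype hqm hx hx1.1 hx' h4 (Ne.symm hne)
    exact hx3.2.2.2 hx2.1
  obtain ⟨hw1, hw2⟩ := h0 p q hpq
  set w := g p q with hw
  have hwm : w ∈ H.binSpan p q := ⟨g, hg, rfl⟩
  have hb1 := htype hpm hqm hpq hwm hw1 hw2
  have hgm : ∀ {x y}, x ∈ H.binSpan p q → y ∈ H.binSpan p q → g x y ∈ H.binSpan p q :=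
    fun hx hy => binSpan_subset hx hy ⟨g, hg, rfl⟩
  have hqw : g q w = p := by
    by_contra hne
    obtain ⟨h1, h2⟩ := h0 q w hb1.1
    exact h2 (huniq (hgm hqm hwm) hwm hne h1 hw1 hw2)
  have hwp : g w p = q := by
    by_contra hne
    obtain ⟨h1, h2⟩ := h0 w p hb1.2.1
    exact h1 (huniq (hgm hwm hpm) hwm h2 hne hw1 hw2)
  have hqp : ¬ H.Adj q p := fun hqp => by
    have := htype hqm hpm hqp hwm hw2 hw1
    exact hb1.2.2.1 this.2.1
  refine ⟨![p, q, w], ⟨?_, ?_⟩, ?_, ?_⟩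
  · intro i
    fin_cases i
    exacts [hpq, hb1.1, hb1.2.1]
  · intro i
    fin_cases i
    exacts [rfl, hqw, hwp]
  · intro i
    fin_cases i
    exacts [hp, hq, hsub hwm]
  · intro i
    fin_cases i
    exacts [hqp, hb1.2.2.1, hb1.2.2.2]

/-- If `g` maps no arc to one of its ends, then nothing dominates a rotor of `g`. Otherwise, above the
rotor there is another one, and the vertices between the two again contain a rotor, and so on,
an infinite descent. -/
lemma IsRotor.not_forall_adj [Finite V] (hH : H.IsSemicomplete) {g : V → V → V}
    (hg : H.IsBinPol g) (h0 : ∀ x y, H.Adj x y → g x y ≠ x ∧ g x y ≠ y) {c : Fin 3 → V}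
    (hc : H.IsRotor g c) (u : V) : ¬ ∀ i, H.Adj u (c i) := by
  intro hu
  -- the vertices between `A` and the rotor `c`
  set S : Set V → Set V := fun A => {w | (∀ i, H.Adj w (c i)) ∧ ∀ a ∈ A, H.Adj a w} with hS
  have key : ∀ n, ∀ A : Set V, (∀ a ∈ A, ∀ i, H.Adj a (c i)) → (S A).ncard = n → ∀ w, w ∉ S A := by
    intro n
    induction n using Nat.strong_induction_on with
    | _ n ih =>
      intro A hA hn w hw
      have hgc : ∀ {v}, (∀ i, H.Adj v (c i)) → ∀ j, H.Adj (g v (c 0)) (c j) := by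
        intro v hv
        refine hc.adj_of_adj_adj hg (i := 1) ?_ ?_
        · simpa [hg.idem] using hg.map (hv 1) (hc.adj 0)
        · have := hg.map (hv 0) (hc.adj 0)
          rwa [hc.apply] at this
      have hclosed : ∀ p ∈ S A, ∀ q ∈ S A, H.binSpan p q ⊆ S A := by
        rintro p hp q hq _ ⟨s, hs, rfl⟩
        exact ⟨fun i => hs.adj_of_adj' (hp.1 i) (hq.1 i),
          fun a ha => hs.adj_of_adj (hp.2 a ha) (hq.2 a ha)⟩
      have hw2 : g w (c 0) ∈ S A := ⟨hgc hw.1, fun a ha => hg.adj_of_adj (hw.2 a ha) (hA a ha 0)⟩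
      have harc : H.Adj w (g w (c 0)) := by
        obtain ⟨h1, h2⟩ := h0 w (c 0) (hw.1 0)
        rcases hg.strictBetween hH h1 h2 with h | h
        · exact h.1
        · exact absurd (hgc hw.1 0) h.2.2.1
      obtain ⟨d, hd, hdS, -⟩ := exists_isRotor hH hg h0 hclosed hw hw2 harc
      refine ih _ ?_ (A ∪ Set.range d) ?_ rfl (g (d 0) (c 0)) ⟨hgc (hdS 0).1, ?_⟩
      · rw [← hn]
        refine Set.ncard_lt_ncard ⟨fun v hv => ⟨hv.1, fun a ha => hv.2 a (Or.inl ha)⟩, fun hsub => ?_⟩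
        exact hH.1 (d 0) ((hsub (hdS 0)).2 _ (Or.inr ⟨0, rfl⟩))
      · rintro a (ha | ⟨i, rfl⟩)
        · exact hA a ha
        · exact (hdS i).1
      · rintro a (ha | ⟨i, rfl⟩)
        · exact hg.adj_of_adj ((hdS 0).2 a ha) (hA a ha 0)
        · refine hd.adj_of_adj_adj' hg (i := 1) ?_ ?_ i
          · have := hg.map (hd.adj 2) ((hdS 0).1 0)
            rwa [show g (d 2) (d 0) = d 1 from hd.apply 2] at this
          · have := hg.map (hd.adj 2) ((hdS 2).1 0)
            rwa [hg.idem] at this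
  exact key _ ∅ (by simp) rfl u ⟨hu, by simp⟩

/-- In the presence of a transitive triple every binary idempotent polymorphism maps some arc to one
of its ends. -/
lemma IsBinPol.exists_eq_fst_or_snd [Finite V] (hH : H.IsSemicomplete) (ht : H.HasTransitiveTriple)
    {g : V → V → V} (hg : H.IsBinPol g) : ∃ x y, H.Adj x y ∧ (g x y = x ∨ g x y = y) := by
  by_contra! h0
  obtain ⟨x, y, z, hxy, hxz, hzy⟩ := ht
  obtain ⟨c, hc, -, hstrict⟩ := exists_isRotor hH hg h0 (S := Set.univ) (fun _ _ _ _ => Set.subset_univ _)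
    trivial trivial hxy
  by_cases hall : ∀ u, ∃ i, u = c i
  · obtain ⟨i, rfl⟩ := hall x
    obtain ⟨j, rfl⟩ := hall y
    obtain ⟨k, rfl⟩ := hall z
    have hne := hH.1
    have : ∀ i j, H.Adj (c i) (c j) → j = i + 1 := by
      intro i j hij
      rcases (show ∀ i j : Fin 3, j = i ∨ j = i + 1 ∨ i = j + 1 by decide) i j with rfl | h | rfl
      · exact absurd hij (hne _)
      · exact h
      · exact absurd hij (hstrict j)
    have h1 := this _ _ hxy
    have h2 := this _ _ hxz
    rw [h1, h2] at hzy
    exact hne _ hzy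
  · push Not at hall
    obtain ⟨u, hu⟩ := hall
    rcases hc.dichotomy hH hg hu with h | h
    · exact hc.not_forall_adj hH hg h0 u h
    · exact hc.op.not_forall_adj hH.op hg.op.swap (fun a b hab => (h0 b a hab).symm) u
        (fun i => h (-i))

/-! ### Binary polymorphisms of strong semicomplete digraphs -/

/-- The sequence that starts with `p 0, …, p (k + 1)` and continues by the rule
`r (n + 1) = g (r n) (r (n - k))`. -/
def pursuit (g : V → V → V) (p : ℕ → V) (k : ℕ) : ℕ → V
  | n => if n ≤ k + 1 then p n else g (pursuit g p k (n - 1)) (pursuit g p k (n - (k + 1)))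
termination_by n => n
decreasing_by all_goals omega

lemma pursuit_of_le {g : V → V → V} {p : ℕ → V} {k n : ℕ} (h : n ≤ k + 1) :
    pursuit g p k n = p n := by
  rw [pursuit, if_pos h]

lemma pursuit_add {g : V → V → V} {p : ℕ → V} {k n : ℕ} :
    pursuit g p k (n + (k + 1) + 1) = g (pursuit g p k (n + (k + 1))) (pursuit g p k (n + 1)) := by
  rw [pursuit, if_neg (by omega)]
  congr 2
  omega

/-- An operation that acts as the first projection on some arc at each vertex, and that fixes one of
the ends of some arc with the arguments in the reverse order, is the first projection on all arcs.

Otherwise there are pairs `(q, c)` such that `q` dominates `g q c'` for all out-neighbours `c'` of `c`.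
Whenever `c` steps to `c'`, the vertex `q` steps to `q' = g q c'`, and `(q', c')` is again such a pair.
So `q` flees from a pursuer `c` that may move along any walk. If `c` keeps moving along a shortest
path to `q`, it retraces the steps of `q` at a constant distance, and the resulting walk must close up,
which the arcs forced along it exclude. -/
lemma IsBinPol.eq_fst_of_adj [Finite V] (hH : H.IsSemicomplete) (hst : H.IsStrong)
    {g : V → V → V} (hg : H.IsBinPol g) (h1 : ∀ x, ∃ y, H.Adj x y ∧ g x y = x)
    (h2 : (∀ x, ∃ y, H.Adj x y ∧ g y x = x) ∨ (∀ y, ∃ x, H.Adj x y ∧ g y x = y))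
    {x y : V} (hxy : H.Adj x y) : g x y = x := by
  classical
  by_contra hne
  have hin : ∀ {c v}, H.Adj c v → H.Adj (g c v) v := by
    intro c v hcv
    obtain ⟨z, hz, hz'⟩ := h1 v
    exact hg.adj_of_eq_fst hz hz' hcv
  let P : V → V → Prop := fun q c => q ≠ c ∧ ∀ c', H.Adj c c' → H.Adj q (g q c')
  have hP0 : P (g x y) y := by
    have hwy := hH.ne_of_adj (hin hxy)
    refine ⟨hwy, fun c' hc' => ?_⟩
    rcases hg.strictBetween hH hne hwy with h | h
    · exact hg.map h.1 hc'
    · exact absurd (hin hxy) h.2.2.1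
  have hback : ∀ {q c}, P q c → ¬ H.Adj c q := by
    intro q c hP hcq
    have := hP.2 q hcq
    rw [hg.idem] at this
    exact hH.1 q this
  have hne' : ∀ {q c c'}, P q c → H.Adj c c' → g q c' ≠ c' := by
    intro q c c' hP hc' heq
    have h3 := hP.2 c' hc'
    rw [heq] at h3
    have h4 := hin h3
    rw [heq] at h4
    exact hH.1 _ h4
  have hPstep : ∀ {q c c'}, P q c → H.Adj c c' → P (g q c') c' := fun hP hc' =>
    ⟨hne' hP hc', fun c'' hc'' => hg.map (hP.2 _ hc') hc''⟩
  have hex : ∃ n, ∃ q c, P q c ∧ H.Walk n c q := by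
    obtain ⟨n, hn⟩ := exists_walk (hst y (g x y))
    exact ⟨n, _, _, hP0, hn⟩
  have hmin : ∀ (n : ℕ) (q c : V), P q c → H.Walk n c q → Nat.find hex ≤ n := fun _ _ _ hP hw =>
    Nat.find_min' hex ⟨_, _, hP, hw⟩
  obtain ⟨q, c, hP, hw⟩ := Nat.find_spec hex
  obtain ⟨d, hd⟩ : ∃ d, d = Nat.find hex := ⟨_, rfl⟩
  rw [← hd] at hw
  rw [← hd] at hmin
  match d, hd, hw, hmin with
  | 0, _, hw, _ => exact hP.1 hw.symm
  | 1, _, hw, _ =>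
    obtain ⟨c', hc', rfl⟩ := hw
    exact hback hP hc'
  | 2, _, hw, _ =>
    -- the value of `g` at the arc `c' → q`, with the arguments in reverse order, contradicts `h2`
    obtain ⟨c', hc', c'', hc'', rfl⟩ := hw
    have h3 := hP.2 _ hc'
    have h4 := hne' hP hc'
    rcases hg.strictBetween hH (hH.ne_of_adj h3).symm h4 with h | h
    · rcases h2 with h2 | h2
      · obtain ⟨z, hz, hz'⟩ := h2 c''
        exact h.2.2.1 (hg.swap.adj_of_eq_fst hz hz' hc'')
      · obtain ⟨z, hz, hz'⟩ := h2 c'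
        exact h.2.2.2 (hg.swap.adj_of_eq_snd hz hz' hc'')
    · exact h.2.2.2 h3
  | k + 3, _, hw, hmin =>
    obtain ⟨p, hp0, hpn, hp⟩ := hw.exists_seq
    -- the walk of the fleeing vertex, `k + 3` steps behind which the pursuer follows
    obtain ⟨r, hr⟩ : ∃ r, r = pursuit g p (k + 2) := ⟨_, rfl⟩
    have hrle : ∀ n ≤ k + 3, r n = p n := fun n hn => hr ▸ pursuit_of_le hn
    have hradd : ∀ n, r (n + (k + 3) + 1) = g (r (n + (k + 3))) (r (n + 1)) := fun n =>
      hr ▸ pursuit_add (k := k + 2)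
    have hboth : ∀ n, P (r (n + (k + 3))) (r n) ∧ ∀ m < n + (k + 3), H.Adj (r m) (r (m + 1)) := by
      intro n
      induction n with
      | zero =>
        refine ⟨?_, fun m hm => ?_⟩
        · rw [hrle _ (by omega), hrle _ (by omega), hp0, Nat.zero_add, hpn]
          exact hP
        · rw [hrle _ (by omega), hrle _ (by omega)]
          exact hp m (by omega)
      | succ n ih =>
        have hadj := ih.2 n (by omega)
        have hidx : n + 1 + (k + 3) = n + (k + 3) + 1 := by omega
        rw [hidx, hradd]
        refine ⟨hPstep ih.1 hadj, fun m hm => ?_⟩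
        rcases Nat.lt_succ_iff_lt_or_eq.1 hm with h | rfl
        · exact ih.2 m h
        · rw [hradd]
          exact ih.1.2 _ hadj
    have hstate := fun n => (hboth n).1
    have hadj : ∀ n, H.Adj (r n) (r (n + 1)) := fun n => (hboth n).2 n (by omega)
    -- otherwise the pursuer could catch up, against the choice of `k + 3` as least distance
    have hfar : ∀ {n v}, H.Adj (r n) v → H.Adj (r (n + (k + 3))) v ∧ ¬ H.Adj v (r (n + (k + 3))) := by
      intro n v hv
      have h3 : ¬ H.Adj v (r (n + (k + 3))) := fun h => by
        have := hmin _ _ _ (hstate n) ((Walk.single hv).trans (Walk.single h))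
        omega
      refine ⟨(hH.2 _ _ ?_).resolve_right h3, h3⟩
      rintro rfl
      have := hmin _ _ _ (hstate n) (Walk.single hv)
      omega
    -- vertices of the walk that are `j` steps apart are joined by a backward arc only, unless `j` is
    -- congruent to `1` modulo `k + 3`
    have hJ : ∀ j, 2 ≤ j → j % (k + 3) ≠ 1 → ∀ n, k + 3 ≤ n →
        H.Adj (r (n + j)) (r n) ∧ ¬ H.Adj (r n) (r (n + j)) := by
      intro j
      induction j using Nat.strong_induction_on with
      | _ j ih =>
        intro hj2 hj1 n hn
        rcases le_or_gt j (k + 3) with hle | hgt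
        · obtain ⟨m, hm⟩ : ∃ m, n + j = m + (k + 3) := ⟨n + j - (k + 3), by omega⟩
          obtain ⟨l, hl⟩ : ∃ l, n = m + l := ⟨n - m, by omega⟩
          have hwalk : H.Walk l (r m) (r n) := hl ▸ Walk.of_forall_adj hadj m l
          rw [hm]
          have h3 : ¬ H.Adj (r n) (r (m + (k + 3))) := fun h => by
            have := hmin _ _ _ (hstate m) (hwalk.trans (Walk.single h))
            omega
          refine ⟨(hH.2 _ _ ?_).resolve_right h3, h3⟩
          intro heq
          rw [← heq] at hwalk
          have := hmin _ _ _ (hstate m) hwalk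
          omega
        · obtain ⟨i, rfl⟩ : ∃ i, j = i + (k + 3) := ⟨j - (k + 3), by omega⟩
          rw [Nat.add_mod_right] at hj1
          have hi2 : 2 ≤ i := by
            by_contra hi
            have : i = 1 := by omega
            subst this
            exact hj1 (Nat.mod_eq_of_lt (by omega))
          have := hfar (ih i (by omega) hi2 hj1 n hn).1
          rwa [add_assoc] at this
    -- the walk meets itself after `N + 1` steps, so an arc of `hJ` is a loop or reverses an arc
    -- of the walk
    obtain ⟨a', b', hab', heq'⟩ := Finite.exists_ne_map_eq_of_infinite (fun m => r (k + 4 + m))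
    obtain ⟨a, N, haN⟩ : ∃ a N, r (k + 4 + a) = r (k + 4 + a + (N + 1)) := by
      rcases lt_or_gt_of_ne hab' with h | h
      · refine ⟨a', b' - a' - 1, heq'.trans (congrArg r ?_)⟩
        omega
      · refine ⟨b', a' - b' - 1, heq'.symm.trans (congrArg r ?_)⟩
        omega
    by_cases hN : (N + 1) % (k + 3) = 1
    · have h3 := (hJ (N + 2) (by omega) (by
        rw [show N + 2 = N + 1 + 1 by rfl, Nat.add_mod, hN, Nat.mod_eq_of_lt (by
          rw [Nat.mod_eq_of_lt] <;> omega), Nat.mod_eq_of_lt (by omega)]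
        omega) (k + 3 + a) (by omega)).2
      rw [show k + 3 + a + (N + 2) = k + 4 + a + (N + 1) by omega, ← haN] at h3
      have h4 := hadj (k + 3 + a)
      rw [show k + 3 + a + 1 = k + 4 + a by omega] at h4
      exact h3 h4
    · have hN2 : 2 ≤ N + 1 := by
        by_contra h
        have : N = 0 := by omega
        subst this
        exact hN (Nat.mod_eq_of_lt (by omega))
      have h3 := (hJ (N + 1) hN2 hN (k + 4 + a) (by omega)).1
      rw [← haN] at h3
      exact hH.1 _ h3

/-- A strong tournament with a transitive triple has a vertex `x` that dominates an arc `z → y`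
of a cycle `z → y → t → z`. -/
lemma exists_adj_adj_of_cycle (hH : H.IsSemicomplete) (hst : H.IsStrong)
    (ht : H.HasTransitiveTriple) (hasymm : ∀ a b, H.Adj a b → ¬ H.Adj b a) :
    ∃ x z y t, H.Adj x z ∧ H.Adj x y ∧ H.Adj z y ∧ H.Adj y t ∧ H.Adj t z := by
  have key : ∀ m, ∀ x z y, H.Adj x z → H.Adj x y → H.Adj z y → H.Walk m y z →
      ∃ x z y t, H.Adj x z ∧ H.Adj x y ∧ H.Adj z y ∧ H.Adj y t ∧ H.Adj t z := by
    intro m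
    induction m with
    | zero =>
      rintro x z y hxz hxy hzy rfl
      exact absurd hzy (hH.1 _)
    | succ m ih =>
      rintro x z y hxz hxy hzy ⟨p, hyp, hw⟩
      by_cases hpz : H.Adj p z
      · exact ⟨x, z, y, p, hxz, hxy, hzy, hyp, hpz⟩
      have hzp : H.Adj z p := hH.adj_of_not (by rintro rfl; exact hasymm _ _ hzy hyp) hpz
      by_cases hpx : H.Adj p x
      · exact ⟨z, y, p, x, hzy, hzp, hyp, hpx, hxy⟩
      · have hxp : H.Adj x p := hH.adj_of_not (by rintro rfl; exact hasymm _ _ hxy hyp) hpx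
        exact ih x z p hxz hxp hzp hw
  obtain ⟨x, y, z, hxy, hxz, hzy⟩ := ht
  obtain ⟨m, hm⟩ := exists_walk (hst y z)
  exact key m x z y hxz hxy hzy hm

/-- No idempotent polymorphism maps both orderings of every arc to the head of the arc. -/
lemma IsBinPol.not_forall_eq_head (hH : H.IsSemicomplete) (hst : H.IsStrong)
    (ht : H.HasTransitiveTriple) {g : V → V → V} (hg : H.IsBinPol g) :
    ¬ ∀ x y, H.Adj x y → g x y = y ∧ g y x = y := by
  intro h
  have hasymm : ∀ a b, H.Adj a b → ¬ H.Adj b a := fun a b hab hba =>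
    hH.ne_of_adj hab ((h b a hba).2.symm.trans (h a b hab).1)
  obtain ⟨x, z, y, t, hxz, hxy, hzy, hyt, htz⟩ := exists_adj_adj_of_cycle hH hst ht hasymm
  have := hg.map hxz hyt
  rw [(h x y hxy).1, (h t z htz).2] at this
  exact hasymm _ _ hzy this

/-- The binary idempotent polymorphisms of a strong semicomplete digraph with a transitive triple
are the two projections. -/
theorem IsBinPol.eq_fst_or_eq_snd [Finite V] (hH : H.IsSemicomplete) (hst : H.IsStrong)
    (ht : H.HasTransitiveTriple) {g : V → V → V} (hg : H.IsBinPol g) :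
    (∀ x y, g x y = x) ∨ (∀ x y, g x y = y) := by
  -- on the arcs, in either order of the arguments, `g` is one of the two projections
  have hα : ∀ {s : V → V → V}, H.IsBinPol s →
      (∀ x, ∃ y, H.Adj x y ∧ s x y = x) ∨ (∀ y, ∃ x, H.Adj x y ∧ s x y = y) := by
    intro s hs
    obtain ⟨x, y, hxy, h | h⟩ := hs.exists_eq_fst_or_snd hH ht
    · exact Or.inl (hs.forall_exists_eq_fst hH hst hxy h)
    · exact Or.inr (hs.forall_exists_eq_snd hH hst hxy h)
  have harc : ∀ {s : V → V → V}, H.IsBinPol s →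
      (∀ x y, H.Adj x y → s x y = x) ∨ (∀ x y, H.Adj x y → s x y = y) := by
    intro s hs
    rcases hα hs with h | h
    · exact Or.inl fun x y => hs.eq_fst_of_adj hH hst h (hα hs.swap)
    · exact Or.inr fun x y hxy =>
        hs.op.swap.eq_fst_of_adj hH.op hst.op h (hα hs.swap).symm hxy
  have hext : ∀ {s : V → V → V} {p : V → V → V}, H.IsBinPol s → (∀ x, p x x = x) →
      (∀ x y, H.Adj x y → s x y = p x y) → (∀ x y, H.Adj x y → s y x = p y x) →
      ∀ x y, s x y = p x y := by
    intro s p hs hp h1 h2 x y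
    rcases eq_or_ne x y with rfl | hne
    · rw [hs.idem, hp]
    · rcases hH.2 x y hne with h | h
      · exact h1 x y h
      · exact h2 y x h
  rcases harc hg with h1 | h1 <;> rcases harc hg.swap with h2 | h2
  · exact absurd (fun x y hxy => ⟨h2 y x hxy, h1 y x hxy⟩)
      (hg.op.not_forall_eq_head hH.op hst.op ht.op)
  · exact Or.inl (hext hg (p := fun x _ => x) (fun _ => rfl) h1 h2)
  · exact Or.inr (hext hg (p := fun _ y => y) (fun _ => rfl) h1 h2)
  · exact absurd (fun x y hxy => ⟨h1 x y hxy, h2 x y hxy⟩) (hg.not_forall_eq_head hH hst ht)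

/-! ### Majority polymorphisms -/

lemma IsStrong.exists_adj_of_mem_of_notMem (hst : H.IsStrong) {S : Set V} {u v : V} (hu : u ∈ S)
    (hv : v ∉ S) : ∃ x ∈ S, ∃ y ∉ S, H.Adj x y := by
  by_contra! h
  have : ∀ w, Relation.ReflTransGen H.Adj u w → w ∈ S := by
    intro w hw
    induction hw with
    | refl => exact hu
    | tail _ hbc ih =>
      by_contra hc
      exact h _ ih _ hc hbc
  exact hv (this v (hst u v))

lemma HasTransitiveTriple.ne (hH : H.IsSemicomplete) (ht : H.HasTransitiveTriple) :
    ∃ x y z : V, x ≠ y ∧ x ≠ z ∧ y ≠ z := by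
  obtain ⟨x, y, z, hxy, hxz, hzy⟩ := ht
  exact ⟨x, y, z, hH.ne_of_adj hxy, hH.ne_of_adj hxz, (hH.ne_of_adj hzy).symm⟩

lemma IsStrong.exists_adj [Nontrivial V] (hst : H.IsStrong) (v : V) : ∃ u, H.Adj v u := by
  obtain ⟨w, hw⟩ := exists_ne v
  obtain ⟨x, rfl, y, -, hxy⟩ := hst.exists_adj_of_mem_of_notMem (S := {v}) rfl hw
  exact ⟨y, hxy⟩

/-- `m` is a majority polymorphism of `H`. -/
structure IsMajority (H : Digraph V) (m : V → V → V → V) : Prop where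
  map : ∀ {a a' b b' c c'}, H.Adj a a' → H.Adj b b' → H.Adj c c' →
    H.Adj (m a b c) (m a' b' c')
  left : ∀ a c, m a a c = a
  mid : ∀ a b, m a b a = a
  right : ∀ a b, m b a a = a

namespace IsMajority

variable {m : V → V → V → V}

lemma op (hm : H.IsMajority m) : H.op.IsMajority m :=
  ⟨fun h h' h'' => hm.map (H := H) h h' h'', hm.left, hm.mid, hm.right⟩

lemma rotate (hm : H.IsMajority m) : H.IsMajority (fun a b c => m b c a) :=
  ⟨fun h h' h'' => hm.map h' h'' h, hm.mid, hm.right, hm.left⟩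

/-- A vertex dominated by two of the arguments is dominated by the value. -/
lemma adj_of_two (hm : H.IsMajority m) (hout : ∀ v, ∃ u, H.Adj v u) {a b c u : V}
    (h : (H.Adj a u ∧ H.Adj b u) ∨ (H.Adj a u ∧ H.Adj c u) ∨ (H.Adj b u ∧ H.Adj c u)) :
    H.Adj (m a b c) u := by
  obtain ⟨a', ha⟩ := hout a
  obtain ⟨b', hb⟩ := hout b
  obtain ⟨c', hc⟩ := hout c
  rcases h with h | h | h
  · simpa [hm.left] using hm.map h.1 h.2 hc
  · simpa [hm.mid] using hm.map h.1 hb h.2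
  · simpa [hm.right] using hm.map ha h.1 h.2

variable [Nontrivial V]

lemma mem (hH : H.IsSemicomplete) (hst : H.IsStrong) (hm : H.IsMajority m) (a b c : V) :
    m a b c = a ∨ m a b c = b ∨ m a b c = c := by
  by_contra! h
  have ha := hH.2 _ _ h.1
  have hb := hH.2 _ _ h.2.1
  have hc := hH.2 _ _ h.2.2
  have h1 := fun h' => hH.1 _ (hm.adj_of_two hst.exists_adj (u := m a b c) h')
  have h2 := fun h' => hH.1 _ (hm.op.adj_of_two (a := a) (b := b) (c := c) hst.op.exists_adj (u := m a b c) h')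
  simp only [op_adj] at h2
  tauto

/-- On the ends of a reversible arc and a third vertex the value is the third vertex. -/
lemma eq_third (hH : H.IsSemicomplete) (hst : H.IsStrong) (hm : H.IsMajority m) {a b c : V}
    (hab : H.Adj a b) (hba : H.Adj b a) (hca : c ≠ a) (hcb : c ≠ b) : m a b c = c := by
  have h1 := @adj_of_two V H m hm hst.exists_adj a b c
  have h2 := @adj_of_two V H.op m hm.op hst.op.exists_adj a b c
  simp only [op_adj] at h2
  rcases hm.mem hH hst a b c with h | h | h
  · exfalso
    rw [h] at h1 h2
    rcases hH.2 c a hca with h' | h'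
    · exact hH.1 a (h1 (.inr (.inr ⟨hba, h'⟩)))
    · exact hH.1 a (h2 (.inr (.inr ⟨hab, h'⟩)))
  · exfalso
    rw [h] at h1 h2
    rcases hH.2 c b hcb with h' | h'
    · exact hH.1 b (h1 (.inr (.inl ⟨hab, h'⟩)))
    · exact hH.1 b (h2 (.inr (.inl ⟨hba, h'⟩)))
  · exact h

/-- On a transitive triple the value is the middle vertex. -/
lemma eq_mid (hH : H.IsSemicomplete) (hst : H.IsStrong) (hm : H.IsMajority m) {x y z : V}
    (hxz : H.Adj x z) (hxy : H.Adj x y) (hzy : H.Adj z y) : m x z y = z := by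
  have h1 := @adj_of_two V H m hm hst.exists_adj x z y
  have h2 := @adj_of_two V H.op m hm.op hst.op.exists_adj x z y
  simp only [op_adj] at h2
  rcases hm.mem hH hst x z y with h | h | h
  · rw [h] at h2
    exact absurd (h2 (.inr (.inr ⟨hxz, hxy⟩))) (hH.1 x)
  · exact h
  · rw [h] at h1
    exact absurd (h1 (.inl ⟨hxy, hzy⟩)) (hH.1 y)

lemma not_reversible (hH : H.IsSemicomplete) (hst : H.IsStrong) (ht : H.HasTransitiveTriple)
    (hm : H.IsMajority m) {a b : V} (hab : H.Adj a b) : ¬ H.Adj b a := by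
  intro hba
  have hno : ∀ {a b c}, H.Adj a b → H.Adj b a → c ≠ a → c ≠ b → ¬ (H.Adj b c ∧ H.Adj c a) := by
    intro a b c hab hba hca hcb h
    have := hm.map hab h.1 h.2
    rw [hm.eq_third hH hst hab hba hca hcb, hm.rotate.eq_third hH hst hab hba hca hcb] at this
    exact hH.1 c this
  have hnbc := fun c (hca : c ≠ a) hcb => hno hab hba hca hcb
  have hnac := fun c (hca : c ≠ a) hcb => hno hba hab hcb hca
  -- every other vertex strictly dominates both `a` and `b`, or is strictly dominated by both
  obtain ⟨v, hva, hvb⟩ : ∃ v, v ≠ a ∧ v ≠ b := by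
    obtain ⟨x, y, z, hxy, hxz, hyz⟩ := ht.ne hH
    by_contra! h
    have hab' : ∀ v, v = a ∨ v = b := fun v => or_iff_not_imp_left.2 (h v)
    rcases hab' x with rfl | rfl <;> rcases hab' y with rfl | rfl <;>
      rcases hab' z with rfl | rfl <;> contradiction
  obtain ⟨x, hx, y, hy, hxy⟩ := hst.exists_adj_of_mem_of_notMem (S := {a, b}) (u := a) (v := v)
    (by simp) (by simp [hva, hvb])
  simp only [Set.mem_insert_iff, Set.mem_singleton_iff, not_or, ← ne_eq] at hx hy
  have hay : H.Adj a y := by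
    rcases hx with rfl | rfl
    · exact hxy
    · by_contra hay
      exact hnbc y hy.1 hy.2 ⟨hxy, hH.adj_of_not hy.1.symm hay⟩
  obtain ⟨c, hc, d, hd, hcd⟩ := hst.exists_adj_of_mem_of_notMem
    (S := {c | c ≠ a ∧ c ≠ b ∧ H.Adj a c}) (u := y) (v := a) ⟨hy.1, hy.2, hay⟩ (by simp)
  obtain ⟨hca, hcb, hac⟩ := hc
  have hncb : ¬ H.Adj c b := fun h => hnac c hca hcb ⟨hac, h⟩
  have hbc := hH.adj_of_not hcb hncb
  have hnca : ¬ H.Adj c a := fun h => hnbc c hca hcb ⟨hbc, h⟩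
  have hda : d ≠ a := by
    rintro rfl
    exact hnca hcd
  have hdb : d ≠ b := by
    rintro rfl
    exact hncb hcd
  have hnad : ¬ H.Adj a d := fun h => hd ⟨hda, hdb, h⟩
  have hda' := hH.adj_of_not hda.symm hnad
  have h1 : m c a d = d := by
    have := hm.map hac hba hcd
    rw [hm.eq_third hH hst hab hba hca hcb] at this
    rcases hm.mem hH hst c a d with h | h | h
    · exact absurd (by rwa [h] at this) (hH.1 c)
    · exact absurd (h ▸ this) hnca
    · exact h
  have h2 : m d c a = d := by
    have := hm.map hcd hac hba
    rw [hm.rotate.rotate.eq_third hH hst hab hba hca hcb] at this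
    rcases hm.mem hH hst d c a with h | h | h
    · exact h
    · exact absurd (by rwa [h] at this) (hH.1 c)
    · exact absurd (h ▸ this) hnca
  have := hm.map hcd hac hda'
  rw [h1, h2] at this
  exact hH.1 d this

end IsMajority

/-- A strong semicomplete digraph with a transitive triple has no majority polymorphism. -/
lemma not_isMajority (hH : H.IsSemicomplete) (hst : H.IsStrong) (ht : H.HasTransitiveTriple)
    (m : V → V → V → V) : ¬ H.IsMajority m := by
  intro hm
  have : Nontrivial V := by
    obtain ⟨x, y, z, hxy, -⟩ := ht.ne hH
    exact ⟨x, y, hxy⟩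
  have hasymm : ∀ a b, H.Adj a b → ¬ H.Adj b a := fun a b => hm.not_reversible hH hst ht
  obtain ⟨x, z, y, t, hxz, hxy, hzy, hyt, htz⟩ := exists_adj_adj_of_cycle hH hst ht hasymm
  have h1 : m z y t = y := by
    have := hm.map hxz hzy hyt
    rw [hm.eq_mid hH hst hxz hxy hzy] at this
    rcases hm.mem hH hst z y t with h | h | h
    · exact absurd (by rwa [h] at this) (hH.1 z)
    · exact h
    · exact absurd (h ▸ this) (hasymm _ _ htz)
  have h2 : m y t z = y := by
    have := hm.map hzy hyt hxz
    rw [hm.rotate.eq_mid hH hst hxz hxy hzy] at this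
    rcases hm.mem hH hst y t z with h | h | h
    · exact h
    · exact absurd (h ▸ this) (hasymm _ _ htz)
    · exact absurd (by rwa [h] at this) (hH.1 z)
  have := hm.map hzy hyt htz
  rw [h1, h2] at this
  exact hH.1 y this

/-! ### Polymorphisms of strong semicomplete digraphs -/

/-- `f` is an idempotent polymorphism of `H` in variables indexed by `ι`. -/
structure IsPol (H : Digraph V) {ι : Type*} (f : (ι → V) → V) : Prop where
  map : ∀ {x y : ι → V}, (∀ i, H.Adj (x i) (y i)) → H.Adj (f x) (f y)
  idem : ∀ v, f (fun _ => v) = v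

namespace IsPol

variable {ι : Type*} {f : (ι → V) → V}

lemma op (hf : H.IsPol f) : H.op.IsPol f := ⟨fun h => hf.map (H := H) h, hf.idem⟩

open Classical in
lemma isBinPol (hf : H.IsPol f) (S : Set ι) :
    H.IsBinPol (fun a b => f (fun j => if j ∈ S then a else b)) := by
  refine ⟨fun h h' => hf.map fun j => ?_, fun x => by simp [hf.idem]⟩
  split_ifs <;> assumption

/-- Some variable `i` determines the value on all tuples that are constant off `i`: a smallest set
of variables that determines the value on the two-valued tuples is a singleton, since otherwise
splitting it would produce a majority polymorphism. -/
lemma exists_coord [Finite V] [Finite ι] (hH : H.IsSemicomplete) (hst : H.IsStrong)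
    (ht : H.HasTransitiveTriple) (hf : H.IsPol f) :
    ∃ i, ∀ (a b : V) (x : ι → V), x i = a → (∀ j, j ≠ i → x j = b) → f x = a := by
  classical
  obtain ⟨p, q, -, hpq, -⟩ := ht.ne hH
  obtain ⟨S, hS, hmin⟩ := Set.exists_min_image
    {S : Set ι | ∀ a b, f (fun j => if j ∈ S then a else b) = a} Set.ncard (Set.toFinite _)
    ⟨Set.univ, fun a b => by simp [hf.idem]⟩
  have hnot : ∀ A : Set ι, A ⊂ S → ∀ a b, f (fun j => if j ∈ A then a else b) = b := by
    intro A hA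
    rcases (hf.isBinPol A).eq_fst_or_eq_snd hH hst ht with h | h
    · exact absurd (hmin A h) (not_le.2 (Set.ncard_lt_ncard hA))
    · exact h
  have hne : S.Nonempty := by
    by_contra hemp
    rw [Set.not_nonempty_iff_eq_empty] at hemp
    have := hS p q
    simp [hemp, hf.idem] at this
    exact hpq this.symm
  obtain ⟨i, hi⟩ := hne
  by_cases hSi : S = {i}
  · refine ⟨i, ?_⟩
    rintro a b x rfl hx
    rw [← hS (x i) b]
    congr 1
    funext j
    by_cases hj : j = i
    · subst hj; simp [hi]
    · simp [hSi, hj, hx j hj]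
  · exfalso
    have hsub1 : {i} ⊂ S := (Set.singleton_subset_iff.2 hi).ssubset_of_ne (Ne.symm hSi)
    have hsub2 : S \ {i} ⊂ S := ⟨Set.sdiff_subset, fun h => (h hi).2 rfl⟩
    refine not_isMajority hH hst ht
      (fun a b c => f (fun j => if j = i then a else if j ∈ S then b else c)) ⟨?_, ?_, ?_, ?_⟩
    · intro a a' b b' c c' ha hb hc
      refine hf.map fun j => ?_
      split_ifs <;> assumption
    · intro a c
      refine Eq.trans (congrArg f ?_) (hS a c)
      funext j
      by_cases hj : j = i
      · subst hj; simp [hi]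
      · simp [hj]
    · intro a b
      refine Eq.trans (congrArg f ?_) (hnot _ hsub2 b a)
      funext j
      by_cases hj : j = i <;> simp [hj]
    · intro a b
      refine Eq.trans (congrArg f ?_) (hnot _ hsub1 b a)
      funext j
      by_cases hj : j = i <;> simp [hj]

/-- If `f x` dominated `x i`, then the same would hold for some tuples `y` whose other variables are
ends of arbitrary backward walks of a common length. By primitivity these can be made equal. -/
lemma not_adj_coord [Finite V] (hH : H.IsSemicomplete) (hst : H.IsStrong)
    (ht : H.HasTransitiveTriple) (hf : H.IsPol f) {i : ι}
    (hi : ∀ (a b : V) (x : ι → V), x i = a → (∀ j, j ≠ i → x j = b) → f x = a) (x : ι → V) :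
    ¬ H.Adj (f x) (x i) := by
  classical
  obtain ⟨e, t, hw⟩ := exists_walk_length hst ht
  have key : ∀ n, ∀ x : ι → V, H.Adj (f x) (x i) → (∀ j, j ≠ i → H.Walk n e (x j)) →
      ∃ y : ι → V, H.Adj (f y) (y i) ∧ ∀ j, j ≠ i → y j = e := by
    intro n
    induction n with
    | zero => exact fun x hx hwx => ⟨x, hx, fun j hj => (hwx j hj).symm⟩
    | succ n ih =>
      intro x hx hwx
      have : ∀ j, ∃ z, H.Adj z (x j) ∧ (j = i → z = f x) ∧ (j ≠ i → H.Walk n e z) := by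
        intro j
        by_cases hj : j = i
        · subst hj
          exact ⟨f x, hx, fun _ => rfl, fun h => absurd rfl h⟩
        · obtain ⟨z, hz, hzx⟩ := walk_succ'.1 (hwx j hj)
          exact ⟨z, hzx, fun h => absurd h hj, fun _ => hz⟩
      choose z hz hzi hzw using this
      refine ih z ?_ hzw
      rw [hzi i rfl]
      exact hf.map hz
  intro hx
  obtain ⟨y, hy, hye⟩ := key t x hx fun j _ => hw (x j)
  rw [hi (y i) e y rfl hye] at hy
  exact hH.1 _ hy

/-- The idempotent polymorphisms of a strong semicomplete digraph with a transitive triple are the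
projections. -/
theorem exists_eq_proj [Finite V] [Finite ι] (hH : H.IsSemicomplete) (hst : H.IsStrong)
    (ht : H.HasTransitiveTriple) (hf : H.IsPol f) : ∃ i, ∀ x, f x = x i := by
  obtain ⟨i, hi⟩ := hf.exists_coord hH hst ht
  refine ⟨i, fun x => ?_⟩
  by_contra hne
  rcases hH.2 _ _ hne with h | h
  · exact hf.not_adj_coord hH hst ht hi x h
  · exact hf.op.not_adj_coord hH.op hst.op ht.op hi x h

end IsPol

end Digraph

/-! ### Exponential growth -/

section Growth

variable {A : Type*}

lemma growth_set_nonempty [Finite A] (F : Operations A) (m : ℕ) :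
    {n | ∃ Γ : Finset (Fin m → A), Γ.card = n ∧
      Generates F m (Γ : Set (Fin m → A))}.Nonempty := by
  classical
  have := Fintype.ofFinite A
  exact ⟨_, Finset.univ, rfl, fun S _ h => Set.univ_subset_iff.1 (by simpa using h)⟩

/-- If every operation of the algebra has a coordinate which is in `P` (in `Q`) whenever the value
is, then every generating set of the `m`-th power meets each of the `2 ^ m` boxes whose sides
are `P` or `Q`: the complement of such a box is a subuniverse. -/
lemma two_pow_le_card_of_generates {F : Operations A} {P Q : Set A} (hP : P.Nonempty)
    (hQ : Q.Nonempty) (hPQ : Disjoint P Q)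
    (hF : ∀ k, ∀ f ∈ F k, ∃ i, ∀ x, (f x ∈ P → x i ∈ P) ∧ (f x ∈ Q → x i ∈ Q)) {m : ℕ}
    {Γ : Finset (Fin m → A)} (hΓ : Generates F m (Γ : Set (Fin m → A))) :
    2 ^ m ≤ Γ.card := by
  classical
  have hmeet : ∀ σ : Fin m → Bool, ∃ v ∈ Γ, ∀ j, v j ∈ if σ j then P else Q := by
    intro σ
    by_contra! hno
    have h := hΓ {v | ¬ ∀ j, v j ∈ if σ j then P else Q} ?_ fun v hv => by simpa using hno v hv
    · obtain ⟨p, hp⟩ := hP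
      obtain ⟨q, hq⟩ := hQ
      have hmem : (fun j => if σ j then p else q) ∈
          {v : Fin m → A | ¬ ∀ j, v j ∈ if σ j then P else Q} := h ▸ Set.mem_univ _
      refine hmem fun j => ?_
      by_cases hj : σ j <;> simp [hj, hp, hq]
    · intro k f hf t ht hall
      obtain ⟨i, hi⟩ := hF k f hf
      refine ht i fun j => ?_
      have := hall j
      by_cases hj : σ j
      · simp only [hj, if_true] at this ⊢
        exact (hi _).1 this
      · simp only [hj] at this ⊢
        exact (hi _).2 this
  choose v hv hv' using hmeet
  have hinj : Function.Injective v := by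
    intro σ τ h
    funext j
    by_contra hne
    have h1 := hv' σ j
    have h2 := hv' τ j
    rw [← h] at h2
    cases hs : σ j <;> cases ht : τ j <;> simp_all
    · exact Set.disjoint_left.1 hPQ h2 h1
    · exact Set.disjoint_left.1 hPQ h1 h2
  calc 2 ^ m = (Finset.univ : Finset (Fin m → Bool)).card := by simp
    _ ≤ Γ.card := Finset.card_le_card_of_injOn v (fun σ _ => hv σ) hinj.injOn

lemma hasEGP_of_disjoint [Finite A] {F : Operations A} {P Q : Set A} (hP : P.Nonempty)
    (hQ : Q.Nonempty) (hPQ : Disjoint P Q)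
    (hF : ∀ k, ∀ f ∈ F k, ∃ i, ∀ x, (f x ∈ P → x i ∈ P) ∧ (f x ∈ Q → x i ∈ Q)) :
    HasEGP F := by
  refine ⟨2, by norm_num, IsBigO.of_bound 1 (Eventually.of_forall fun m => ?_)⟩
  have h : 2 ^ m ≤ growth F m := by
    refine le_csInf (growth_set_nonempty F m) ?_
    rintro _ ⟨Γ, rfl, hΓ⟩
    exact two_pow_le_card_of_generates hP hQ hPQ hF hΓ
  simpa using (by exact_mod_cast h : (2 : ℝ) ^ m ≤ growth F m)

end Growth

namespace Digraph

variable {V : Type*} {H : Digraph V}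

lemma IsPol.of_mem_idPol {k : ℕ} {f : (Fin k → V) → V} (hf : f ∈ H.idPol k) : H.IsPol f :=
  ⟨fun h => hf.2.1 _ _ h, hf.2.2⟩

/-- Suppose that all idempotent polymorphisms are projections on a set `C` that dominates every
vertex. The fibres of `v ↦ N⁻(v) ∩ C` over minimal elements of the image are then reflected by each
polymorphism in its coordinate, and there are two of them: one below any element of the other's
in-neighbourhood. -/
lemma hasEGP_of_proj [Finite V] [Nonempty V] (hH : H.IsSemicomplete) {C : Set V}
    (hC : ∀ v, ∃ c ∈ C, H.Adj c v)
    (hproj : ∀ (k : ℕ) (f : (Fin k → V) → V), H.IsPol f →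
      ∃ i, ∀ x, (∀ j, x j ∈ C) → f x = x i) : HasEGP H.idPol := by
  set N : V → Set V := fun v => {c | c ∈ C ∧ H.Adj c v} with hN
  have hmin : ∀ c, ∃ a, N a ⊆ N c ∧ ∀ v, N v ⊆ N a → N v = N a := by
    intro c
    obtain ⟨a, ha, ha'⟩ := Set.exists_min_image {a | N a ⊆ N c} (fun a => (N a).ncard)
      (Set.toFinite _) ⟨c, Set.Subset.refl _⟩
    exact ⟨a, ha, fun v hv => Set.eq_of_subset_of_ncard_le hv (ha' v (hv.trans ha))⟩
  obtain ⟨a, -, ha⟩ := hmin (Classical.arbitrary V)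
  obtain ⟨c, hcC, hca⟩ := hC a
  obtain ⟨b, hbc, hb⟩ := hmin c
  refine hasEGP_of_disjoint (P := {v | N v = N a}) (Q := {v | N v = N b}) ⟨a, rfl⟩ ⟨b, rfl⟩ ?_ ?_
  · refine Set.disjoint_left.2 fun v hva hvb => ?_
    have hc : c ∈ N a := ⟨hcC, hca⟩
    rw [← hva.out, hvb.out] at hc
    exact hH.1 c (hbc hc).2
  · intro k f hf
    have hf' := IsPol.of_mem_idPol hf
    obtain ⟨i, hi⟩ := hproj k f hf'
    have hsub : ∀ x, N (x i) ⊆ N (f x) := by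
      rintro x d ⟨hd, hdx⟩
      choose y hy hyx using fun j => hC (x j)
      have hy' : ∀ j, Function.update y i d j ∈ C := fun j => by
        by_cases hj : j = i
        · subst hj; simpa using hd
        · simpa [hj] using hy j
      refine ⟨hd, ?_⟩
      have := hi _ hy'
      rw [Function.update_self] at this
      rw [← this]
      refine hf'.map fun j => ?_
      by_cases hj : j = i
      · subst hj; simpa using hdx
      · simpa [hj] using hyx j
    exact ⟨i, fun x => ⟨fun h => ha _ (h ▸ hsub x), fun h => hb _ (h ▸ hsub x)⟩⟩

/-! ### Cycles and closed walks -/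

/-- The arc `a → b` lies on a closed walk. -/
def CycleArc (H : Digraph V) (a b : V) : Prop := H.Adj a b ∧ Relation.ReflTransGen H.Adj b a

lemma Walk.of_forall_lt {c : ℕ → V} {n : ℕ} (h : ∀ i < n, H.Adj (c i) (c (i + 1))) {i k : ℕ}
    (hk : i + k ≤ n) : H.Walk k (c i) (c (i + k)) := by
  induction k with
  | zero => rfl
  | succ k ih => exact walk_succ'.2 ⟨_, ih (by omega), h _ (by omega)⟩

/-- A shortest path closes an arc of a closed walk to a cycle. -/
lemma CycleArc.exists_isCycle {a b : V} (h : H.CycleArc a b) : ∃ D, H.IsCycle D ∧ (a, b) ∈ D := by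
  classical
  have hex := exists_walk h.2
  have hmin := fun m => Nat.find_min (m := m) hex
  obtain ⟨c, h0, hn, hc⟩ := (Nat.find_spec hex).exists_seq
  set n := Nat.find hex
  have hlt : ∀ i j, i < j → j ≤ n → c i ≠ c j := by
    intro i j hij hj heq
    refine hmin (i + (n - j)) (by omega) ?_
    have h1 := Walk.of_forall_lt hc (i := 0) (k := i) (by omega)
    have h2 := Walk.of_forall_lt hc (i := j) (k := n - j) (by omega)
    rw [Nat.add_sub_cancel' hj, hn] at h2
    rw [zero_add, heq, h0] at h1
    exact h1.trans h2
  refine ⟨_, ⟨n, fun i => c i, ?_, ?_, rfl⟩, Fin.last n, ?_⟩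
  · intro i j hij
    by_contra hne
    rcases lt_or_gt_of_ne hne with h' | h'
    · exact hlt i j h' (by omega) hij
    · exact hlt j i h' (by omega) hij.symm
  · intro i
    by_cases hi : i = Fin.last n
    · subst hi
      simpa [hn, h0] using h.1
    · have := Fin.val_add_one_of_lt (Fin.lt_last_iff_ne_last.2 hi)
      simp only [this]
      exact hc i (Fin.lt_last_iff_ne_last.2 hi)
  · simp [hn, h0]

lemma reflTransGen_of_cycle {n : ℕ} {c : Fin (n + 1) → V} (hc : ∀ i, H.Adj (c i) (c (i + 1)))
    (i j : Fin (n + 1)) : Relation.ReflTransGen H.Adj (c i) (c j) := by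
  have h1 : Relation.ReflTransGen H.Adj (c i) (c (Fin.last n)) := by
    induction i using Fin.reverseInduction with
    | last => exact .refl
    | cast i ih => exact .head (Fin.coeSucc_eq_succ (a := i) ▸ hc i.castSucc) ih
  have h2 : Relation.ReflTransGen H.Adj (c 0) (c j) := by
    induction j using Fin.induction with
    | zero => exact .refl
    | succ j ih => exact ih.tail (Fin.coeSucc_eq_succ (a := j) ▸ hc j.castSucc)
  exact (h1.tail (Fin.last_add_one n ▸ hc (Fin.last n))).trans h2

/-- There is at most one cycle precisely if the vertices on closed walks form at most one strong
component and that component is a cycle. -/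
lemma hasAtMostOneCycle_iff : H.HasAtMostOneCycle ↔
    (∀ a b b', H.CycleArc a b → H.CycleArc a b' → b = b') ∧
    (∀ a b a' b', H.CycleArc a b → H.CycleArc a' b' → Relation.ReflTransGen H.Adj a a') := by
  constructor
  · intro h
    have key : ∀ {a b a' b'}, H.CycleArc a b → H.CycleArc a' b' →
        ∃ D, H.IsCycle D ∧ (a, b) ∈ D ∧ (a', b') ∈ D := by
      intro a b a' b' h1 h2
      obtain ⟨D, hD, hm⟩ := h1.exists_isCycle
      obtain ⟨E, hE, hm'⟩ := h2.exists_isCycle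
      exact ⟨D, hD, hm, h D E hD hE ▸ hm'⟩
    constructor
    · intro a b b' h1 h2
      obtain ⟨_, ⟨n, c, hinj, -, rfl⟩, ⟨i, hi⟩, ⟨j, hj⟩⟩ := key h1 h2
      simp only [Prod.mk.injEq] at hi hj
      obtain rfl := hinj (hi.1.trans hj.1.symm)
      exact hi.2.symm.trans hj.2
    · intro a b a' b' h1 h2
      obtain ⟨_, ⟨n, c, -, hc, rfl⟩, ⟨i, hi⟩, ⟨j, hj⟩⟩ := key h1 h2
      simp only [Prod.mk.injEq] at hi hj
      rw [← hi.1, ← hj.1]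
      exact reflTransGen_of_cycle hc i j
  · rintro ⟨h1, h2⟩
    suffices hall : ∀ D, H.IsCycle D → D = {p | H.CycleArc p.1 p.2} from
      fun D E hD hE => (hall D hD).trans (hall E hE).symm
    rintro _ ⟨n, c, -, hc, rfl⟩
    have harc : ∀ i, H.CycleArc (c i) (c (i + 1)) := fun i => ⟨hc i, reflTransGen_of_cycle hc _ _⟩
    refine Set.Subset.antisymm (by rintro _ ⟨i, rfl⟩; exact harc i) ?_
    rintro ⟨a, b⟩ (hab : H.CycleArc a b)
    have hmem : ∀ x, Relation.ReflTransGen H.Adj x a → (∃ i, c i = x) → ∃ i, c i = a := by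
      intro x hx
      induction hx using Relation.ReflTransGen.head_induction_on with
      | refl => exact id
      | head hxy hya ih =>
        rintro ⟨i, rfl⟩
        exact ih ⟨i + 1, h1 _ _ _ (harc i) ⟨hxy, hya.trans (h2 _ _ _ _ hab (harc i))⟩⟩
    obtain ⟨i, rfl⟩ := hmem (c 0) (h2 _ _ _ _ (harc 0) hab) ⟨0, rfl⟩
    exact ⟨i, Prod.ext rfl (h1 _ _ _ (harc i) hab)⟩

lemma CycleArc.op {a b : V} (h : H.CycleArc a b) : H.op.CycleArc b a :=
  ⟨h.1, (Relation.reflTransGen_swap (r := H.Adj)).2 h.2⟩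

lemma HasAtMostOneCycle.op (hH : H.IsSemicomplete) (h : H.HasAtMostOneCycle) :
    H.op.HasAtMostOneCycle := by
  rw [hasAtMostOneCycle_iff] at h ⊢
  obtain ⟨h1, h2⟩ := h
  have back : ∀ {a b}, H.op.CycleArc a b → H.CycleArc b a := fun h => h.op
  have inj : ∀ a b b', H.CycleArc b a → H.CycleArc b' a → ¬ H.Adj b b' := by
    intro a b b' hb hb' hadj
    have := h1 _ _ _ hb ⟨hadj, .head hb'.1 hb.2⟩
    subst this
    exact hH.1 _ hb'.1
  constructor
  · intro a b b' hb hb'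
    by_contra hne
    rcases hH.2 b b' hne with h | h
    · exact inj _ _ _ (back hb) (back hb') h
    · exact inj _ _ _ (back hb') (back hb) h
  · intro a b a' b' hb hb'
    refine (Relation.reflTransGen_swap (r := H.Adj)).2 ?_
    have hb := back hb
    have hb' := back hb'
    exact (hb'.2.trans (h2 _ _ _ _ hb' hb)).tail hb.1

/-! ### Strong components -/

/-- The subdigraph induced on `S`. -/
def restrict (H : Digraph V) (S : Set V) : Digraph S := ⟨fun a b => H.Adj a b⟩

lemma IsSemicomplete.restrict (hH : H.IsSemicomplete) (S : Set V) :
    (H.restrict S).IsSemicomplete :=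
  ⟨fun x => hH.1 x, fun x y h => hH.2 x y fun h' => h (Subtype.ext h')⟩

lemma isStrong_restrict {S : Set V}
    (hconn : ∀ a ∈ S, ∀ b ∈ S, Relation.ReflTransGen H.Adj a b)
    (hconv : ∀ a ∈ S, ∀ b ∈ S, ∀ y, Relation.ReflTransGen H.Adj a y →
      Relation.ReflTransGen H.Adj y b → y ∈ S) : (H.restrict S).IsStrong := by
  rintro ⟨a, ha⟩ ⟨b, hb⟩
  have : ∀ x, Relation.ReflTransGen H.Adj x b → ∀ hx : x ∈ S,
      Relation.ReflTransGen (H.restrict S).Adj ⟨x, hx⟩ ⟨b, hb⟩ := by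
    intro x hx
    induction hx using Relation.ReflTransGen.head_induction_on with
    | refl => exact fun _ => .refl
    | head hxy hyb ih =>
      intro hx
      have hy := hconv _ hx b hb _ (.single hxy) hyb
      exact .head (show (H.restrict S).Adj ⟨_, hx⟩ ⟨_, hy⟩ from hxy) (ih hy)
  exact this a (hconn a ha b hb) ha

lemma exists_adj_mem {S : Set V} (hS : (H.restrict S).IsStrong) (hnt : S.Nontrivial) {v : V}
    (hv : v ∈ S) : ∃ u ∈ S, H.Adj v u := by
  have := hnt.coe_sort
  obtain ⟨u, hu⟩ := hS.exists_adj ⟨v, hv⟩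
  exact ⟨u, u.2, hu⟩

lemma exists_mem_adj {S : Set V} (hS : (H.restrict S).IsStrong) (hnt : S.Nontrivial) {v : V}
    (hv : v ∈ S) : ∃ u ∈ S, H.Adj u v :=
  exists_adj_mem (H := H.op) (S := S) hS.op hnt hv

lemma eq_of_adj_of_adj (hH : H.IsSemicomplete) {S : Set V}
    (ht : ¬ (H.restrict S).HasTransitiveTriple) {v a b : V} (hv : v ∈ S) (ha : a ∈ S) (hb : b ∈ S)
    (hva : H.Adj v a) (hvb : H.Adj v b) : a = b := by
  by_contra hab
  exact ht (HasTransitiveTriple.of_adj_adj (hH.restrict S) (v := ⟨v, hv⟩) (a := ⟨a, ha⟩)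
    (b := ⟨b, hb⟩) (fun h => hab (congrArg Subtype.val h)) hva hvb)

lemma eq_of_adj_of_adj' (hH : H.IsSemicomplete) {S : Set V}
    (ht : ¬ (H.restrict S).HasTransitiveTriple) {v a b : V} (hv : v ∈ S) (ha : a ∈ S) (hb : b ∈ S)
    (hva : H.Adj a v) (hvb : H.Adj b v) : a = b :=
  eq_of_adj_of_adj (H := H.op) hH.op (S := S) (fun h => ht h.op) hv ha hb hva hvb

lemma reflTransGen_of_ncard_le [Finite V] {u v : V} (h : Relation.ReflTransGen H.Adj u v)
    (hle : {w | Relation.ReflTransGen H.Adj w v}.ncard ≤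
      {w | Relation.ReflTransGen H.Adj w u}.ncard) : Relation.ReflTransGen H.Adj v u := by
  have : {w | Relation.ReflTransGen H.Adj w u} = {w | Relation.ReflTransGen H.Adj w v} :=
    Set.eq_of_subset_of_ncard_le (fun w hw => hw.trans h) hle
  have hv : v ∈ {w | Relation.ReflTransGen H.Adj w v} := .refl
  rwa [← this] at hv

/-- `C` is the initial strong component of a semicomplete digraph without sources. -/
structure IsInitial (H : Digraph V) (C : Set V) : Prop where
  strong : (H.restrict C).IsStrong
  nontrivial : C.Nontrivial
  adj : ∀ {c v}, c ∈ C → v ∉ C → H.Adj c v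
  not_adj : ∀ {c v}, c ∈ C → v ∉ C → ¬ H.Adj v c

lemma exists_isInitial [Finite V] [Nonempty V] (hH : H.IsSemicomplete)
    (hs : ∀ s, ¬ H.IsSource s) : ∃ C, H.IsInitial C := by
  obtain ⟨v, -, hv⟩ := Set.exists_min_image Set.univ
    (fun v => {u | Relation.ReflTransGen H.Adj u v}.ncard) (Set.toFinite _) Set.univ_nonempty
  have hback : ∀ u, Relation.ReflTransGen H.Adj u v → Relation.ReflTransGen H.Adj v u := by
    intro u hu
    exact reflTransGen_of_ncard_le hu (hv u trivial)
  have hnot : ∀ {c w}, Relation.ReflTransGen H.Adj c v → ¬ Relation.ReflTransGen H.Adj w v →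
      ¬ H.Adj w c := fun hc hw h => hw (.head h hc)
  refine ⟨{u | Relation.ReflTransGen H.Adj u v}, isStrong_restrict ?_ ?_, ?_, ?_, hnot⟩
  · exact fun a ha b hb => ha.out.trans (hback b hb)
  · exact fun a _ b hb y _ hy => hy.trans hb
  · have := hs v
    rw [IsSource] at this
    push Not at this
    obtain ⟨u, hu⟩ := this
    exact ⟨u, .single hu, v, .refl, hH.ne_of_adj hu⟩
  · intro c w hc hw
    exact hH.adj_of_not (fun h => hw (h ▸ hc)) (hnot hc hw)

namespace IsInitial

variable {C : Set V}

lemma exists_mem_adj (hC : H.IsInitial C) (v : V) : ∃ c ∈ C, H.Adj c v := by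
  by_cases hv : v ∈ C
  · exact Digraph.exists_mem_adj hC.strong hC.nontrivial hv
  · obtain ⟨c, hc⟩ := hC.nontrivial.nonempty
    exact ⟨c, hc, hC.adj hc hv⟩

lemma mem_of_reflTransGen (hC : H.IsInitial C) {u v : V} (h : Relation.ReflTransGen H.Adj u v)
    (hv : v ∈ C) : u ∈ C := by
  induction h using Relation.ReflTransGen.head_induction_on with
  | refl => exact hv
  | head h _ ih => exact by_contra fun hu => hC.not_adj ih hu h

lemma apply_mem (hH : H.IsSemicomplete) (hC : H.IsInitial C) {ι : Type*} {f : (ι → V) → V}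
    (hf : H.IsPol f) {x : ι → V} (hx : ∀ i, x i ∈ C) : f x ∈ C := by
  by_contra h
  have := hf.map (x := x) (y := fun _ => f x) fun i => hC.adj (hx i) h
  rw [hf.idem] at this
  exact hH.1 _ this

end IsInitial

lemma IsPol.restrict {ι : Type*} {f : (ι → V) → V} (hf : H.IsPol f) {S : Set V}
    (hS : ∀ x : ι → V, (∀ i, x i ∈ S) → f x ∈ S) :
    (H.restrict S).IsPol fun x : ι → S => ⟨f fun i => x i, hS _ fun i => (x i).2⟩ :=
  ⟨fun h => hf.map h, fun _ => Subtype.ext (hf.idem _)⟩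

lemma IsBinPol.restrict {s : V → V → V} (hs : H.IsBinPol s) {S : Set V}
    (hS : ∀ a ∈ S, ∀ b ∈ S, s a b ∈ S) :
    (H.restrict S).IsBinPol fun a b : S => ⟨s a b, hS _ a.2 _ b.2⟩ :=
  ⟨fun h h' => hs.map h h', fun _ => Subtype.ext (hs.idem _)⟩

lemma IsPol.walk {ι : Type*} {f : (ι → V) → V} (hf : H.IsPol f) {n : ℕ} {x y : ι → V}
    (h : ∀ i, H.Walk n (x i) (y i)) : H.Walk n (f x) (f y) := by
  induction n generalizing x with
  | zero => exact congrArg f (funext h)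
  | succ n ih =>
    choose c hc hc' using h
    exact ⟨f c, hf.map hc, ih hc'⟩

/-- Idempotent polymorphisms preserve the set of vertices on closed walks. -/
lemma IsPol.exists_cycleArc {ι : Type*} [Finite ι] {f : (ι → V) → V} (hf : H.IsPol f) {x : ι → V}
    (h : ∀ i, ∃ b, H.CycleArc (x i) b) : ∃ b, H.CycleArc (f x) b := by
  have := Fintype.ofFinite ι
  have hw : ∀ i, ∃ n, H.Walk (n + 1) (x i) (x i) := fun i => by
    obtain ⟨b, hb, hb'⟩ := h i
    obtain ⟨n, hn⟩ := exists_walk hb'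
    exact ⟨n, b, hb, hn⟩
  choose n hn using hw
  have hN : ∀ i, H.Walk (∏ j, (n j + 1)) (x i) (x i) := fun i => by
    obtain ⟨q, hq⟩ := Finset.dvd_prod_of_mem (fun j => n j + 1) (Finset.mem_univ i)
    rw [hq, mul_comm]
    exact (hn i).mul q
  have h := hf.walk hN
  obtain ⟨N, hN⟩ := Nat.exists_eq_succ_of_ne_zero
    (Finset.prod_pos fun j (_ : j ∈ Finset.univ) => Nat.succ_pos (n j)).ne'
  rw [show ∏ j, (n j + 1) = N + 1 from hN] at h
  obtain ⟨b, hb, hb'⟩ := h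
  exact ⟨b, hb, hb'.reflTransGen⟩

/-! ### Polymorphisms on an initial component that is a cycle -/

section CyclicInitial

variable {C D : Set V} {k : ℕ} {f : (Fin k → V) → V}

open Classical in
/-- Let the initial component `C` be a cycle and `D` a second nontrivial component, closest to `C`.
If fixing the coordinates in `S` to some values in `C` forces `f` to leave `C` as soon as the other
coordinates are set to an element of `D`, then on `D` the other coordinates decide. -/
lemma forall_eq_snd [Finite V] (hH : H.IsSemicomplete) (hC : H.IsInitial C)
    (hD : (H.restrict D).IsStrong) (hDnt : D.Nontrivial) (hDC : Disjoint C D)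
    (hconv : ∀ a ∈ D, ∀ b ∈ D, ∀ y, Relation.ReflTransGen H.Adj a y →
      Relation.ReflTransGen H.Adj y b → y ∈ D)
    (hclosest : ∀ u ∉ C, (∃ b, H.CycleArc u b) → ∀ d ∈ D, Relation.ReflTransGen H.Adj u d →
      u ∈ D)
    (hf : H.IsPol f) {S : Set (Fin k)} {x : Fin k → V} (hx : ∀ i, x i ∈ C)
    (hleave : ∀ r ∈ D, f (fun j => if j ∈ S then x j else r) ∉ C) {a b : V} (ha : a ∈ D)
    (hb : b ∈ D) : f (fun j => if j ∈ S then a else b) = b := by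
  have hnot : ∀ {d}, d ∈ D → d ∉ C := fun hd hc => Set.disjoint_left.1 hDC hc hd
  have hcyc : ∀ {E : Set V}, (H.restrict E).IsStrong → E.Nontrivial → ∀ v ∈ E,
      ∃ b, H.CycleArc v b := by
    intro E hE hEnt v hv
    obtain ⟨w, hw, hvw⟩ := exists_adj_mem hE hEnt hv
    exact ⟨w, hvw, (hE ⟨w, hw⟩ ⟨v, hv⟩).lift Subtype.val fun _ _ h => h⟩
  have hadj : ∀ r a b, a ∈ D → b ∈ D → H.Adj r b →
      H.Adj (f fun j => if j ∈ S then x j else r) (f fun j => if j ∈ S then a else b) := by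
    intro r a b ha hb hrb
    refine hf.map fun j => ?_
    by_cases hj : j ∈ S
    · simpa [hj] using hC.adj (hx j) (hnot ha)
    · simpa [hj] using hrb
  have hmem : ∀ r ∈ D, (f fun j => if j ∈ S then x j else r) ∈ D := by
    intro r hr
    obtain ⟨b, hb, hrb⟩ := exists_adj_mem hD hDnt hr
    refine hclosest _ (hleave r hr) (hf.exists_cycleArc fun j => ?_) b hb (.single ?_)
    · by_cases hj : j ∈ S
      · simpa [hj] using hcyc hC.strong hC.nontrivial _ (hx j)
      · simpa [hj] using hcyc hD hDnt _ hr
    · simpa [hf.idem] using hadj r b b hb hb hrb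
  have hg := hf.isBinPol S
  have hgD : ∀ a ∈ D, ∀ b ∈ D, (f fun j => if j ∈ S then a else b) ∈ D := by
    intro a ha b hb
    by_cases h1 : (f fun j => if j ∈ S then a else b) = a
    · rwa [h1]
    by_cases h2 : (f fun j => if j ∈ S then a else b) = b
    · rwa [h2]
    rcases hg.strictBetween hH h1 h2 with h | h
    · exact hconv _ ha _ hb _ (.single h.1) (.single h.2.1)
    · exact hconv _ hb _ ha _ (.single h.1) (.single h.2.1)
  obtain ⟨r, hr, hrb⟩ := exists_mem_adj hD hDnt hb
  by_cases ht : (H.restrict D).HasTransitiveTriple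
  · rcases (hg.restrict hgD).eq_fst_or_eq_snd (hH.restrict D) hD ht with h | h
    · have h1 := hadj r _ b (hmem r hr) hb hrb
      have h2 := congrArg Subtype.val (h ⟨_, hmem r hr⟩ ⟨b, hb⟩)
      simp only at h2
      rw [h2] at h1
      exact absurd h1 (hH.1 _)
    · exact congrArg Subtype.val (h ⟨a, ha⟩ ⟨b, hb⟩)
  · refine eq_of_adj_of_adj hH ht (hmem r hr) (hgD a ha b hb) hb (hadj r a b ha hb hrb) ?_
    simpa [hf.idem] using hadj r b b hb hb hrb

open Classical in
/-- If setting the coordinates outside of `S` to some element outside of `C` is compatible with a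
value in `C`, whatever the coordinates in `S`, then the latter determine `f` on `C`. -/
lemma determined (hH : H.IsSemicomplete) (hC : H.IsInitial C)
    (ht : ¬ (H.restrict C).HasTransitiveTriple) (hf : H.IsPol f) {S : Set (Fin k)}
    (h : ∀ x : Fin k → V, (∀ i, x i ∈ C) →
      ∃ r ∉ C, f (fun j => if j ∈ S then x j else r) ∈ C)
    {y z : Fin k → V} (hy : ∀ i, y i ∈ C) (hz : ∀ i, z i ∈ C) (hyz : ∀ i ∈ S, y i = z i) :
    f y = f z := by
  choose x hx hyx using fun i => exists_adj_mem hC.strong hC.nontrivial (hy i)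
  obtain ⟨r, hr, hv⟩ := h x hx
  refine eq_of_adj_of_adj' hH ht hv (hC.apply_mem hH hf hy) (hC.apply_mem hH hf hz)
    (hf.map fun j => ?_) (hf.map fun j => ?_)
  · by_cases hj : j ∈ S
    · simpa [hj] using hyx j
    · simpa [hj] using hC.adj (hy j) hr
  · by_cases hj : j ∈ S
    · simpa [hj, ← hyz j hj] using hyx j
    · simpa [hj] using hC.adj (hz j) hr

open Classical in
lemma exists_eq_proj_of_not_hasTransitiveTriple [Finite V] (hH : H.IsSemicomplete)
    (hC : H.IsInitial C) (ht : ¬ (H.restrict C).HasTransitiveTriple)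
    (h : ¬ H.HasAtMostOneCycle) (hf : H.IsPol f) :
    ∃ i, ∀ x, (∀ j, x j ∈ C) → f x = x i := by
  have hreach : ∀ {a b}, a ∈ C → b ∈ C → Relation.ReflTransGen H.Adj a b := fun ha hb =>
    (hC.strong ⟨_, ha⟩ ⟨_, hb⟩).lift Subtype.val fun _ _ h => h
  -- a second nontrivial component
  have hex : {r | r ∉ C ∧ ∃ b, H.CycleArc r b}.Nonempty := by
    by_contra hno
    rw [Set.not_nonempty_iff_eq_empty, Set.eq_empty_iff_forall_notMem] at hno
    have hin : ∀ {a b}, H.CycleArc a b → a ∈ C ∧ b ∈ C := by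
      intro a b hab
      have ha : a ∈ C := by_contra fun ha => hno a ⟨ha, b, hab⟩
      exact ⟨ha, hC.mem_of_reflTransGen hab.2 ha⟩
    refine h (hasAtMostOneCycle_iff.2 ⟨fun a b b' h1 h2 => ?_, fun a b a' b' h1 h2 => ?_⟩)
    · exact eq_of_adj_of_adj hH ht (hin h1).1 (hin h1).2 (hin h2).2 h1.1 h2.1
    · exact hreach (hin h1).1 (hin h2).1
  obtain ⟨r, ⟨hrC, s, hrs, hsr⟩, hmin⟩ := Set.exists_min_image _
    (fun v => {u | Relation.ReflTransGen H.Adj u v}.ncard) (Set.toFinite _) hex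
  set D : Set V := {u | Relation.ReflTransGen H.Adj u r ∧ Relation.ReflTransGen H.Adj r u}
  have hconv : ∀ a ∈ D, ∀ b ∈ D, ∀ y, Relation.ReflTransGen H.Adj a y →
      Relation.ReflTransGen H.Adj y b → y ∈ D :=
    fun a ha b hb y h1 h2 => ⟨h2.trans hb.1, ha.2.trans h1⟩
  have hD := isStrong_restrict (fun a ha b hb => ha.1.trans hb.2) hconv
  have hDnt : D.Nontrivial := ⟨r, ⟨.refl, .refl⟩, s, ⟨hsr, .single hrs⟩, hH.ne_of_adj hrs⟩
  have hDC : Disjoint C D :=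
    Set.disjoint_left.2 fun u hu hu' => hrC (hC.mem_of_reflTransGen hu'.2 hu)
  have hclosest : ∀ u ∉ C, (∃ b, H.CycleArc u b) → ∀ d ∈ D, Relation.ReflTransGen H.Adj u d →
      u ∈ D := by
    intro u hu hb d hd hud
    have hur := hud.trans hd.1
    exact ⟨hur, reflTransGen_of_ncard_le hur (hmin u ⟨hu, hb⟩)⟩
  have key : ∀ {S : Set (Fin k)} {a b : V}, a ∈ D → b ∈ D →
      f (fun j => if j ∈ S then a else b) ≠ b → ∀ {y z : Fin k → V}, (∀ i, y i ∈ C) →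
      (∀ i, z i ∈ C) → (∀ i ∈ S, y i = z i) → f y = f z := by
    intro S a b ha hb hne y z hy hz hyz
    refine determined hH hC ht hf (fun x hx => ?_) hy hz hyz
    by_contra! hno
    exact hne (forall_eq_snd hH hC hD hDnt hDC hconv hclosest hf hx
      (fun r hr => hno r fun hc => Set.disjoint_left.1 hDC hc hr) ha hb)
  -- for each set of coordinates, `f` depends on `C` only on it or only on its complement
  have hdich : ∀ S : Set (Fin k),
      (∀ y z : Fin k → V, (∀ i, y i ∈ C) → (∀ i, z i ∈ C) → (∀ i ∈ S, y i = z i) → f y = f z) ∨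
      (∀ y z : Fin k → V, (∀ i, y i ∈ C) → (∀ i, z i ∈ C) → (∀ i ∈ Sᶜ, y i = z i) →
        f y = f z) := by
    intro S
    obtain ⟨a, ha, b, hb, hab⟩ := hDnt
    by_cases hv : f (fun j => if j ∈ S then a else b) = b
    · refine .inr fun y z hy hz hyz => key (a := b) (b := a) hb ha (fun h' => hab ?_) hy hz hyz
      rw [← h', ← hv]
      exact congrArg f (funext fun j => by by_cases hj : j ∈ S <;> simp [hj, hv])
    · exact .inl fun y z hy hz hyz => key ha hb hv hy hz hyz
  by_contra! hno
  have hindep : ∀ i, ∀ y z : Fin k → V, (∀ i, y i ∈ C) → (∀ i, z i ∈ C) →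
      (∀ j, j ≠ i → y j = z j) → f y = f z := by
    intro i
    rcases hdich {i} with h | h
    · obtain ⟨x, hx, hne⟩ := hno i
      refine absurd ?_ hne
      rw [h x (fun _ => x i) hx (fun _ => hx i) (by simp), hf.idem]
    · exact fun y z hy hz hyz => h y z hy hz fun j hj => hyz j hj
  obtain ⟨a, ha, b, hb, hab⟩ := hC.nontrivial
  have hall : ∀ s : Finset (Fin k), f (fun j => if j ∈ s then a else b) = b := by
    intro s
    induction s using Finset.induction_on with
    | empty => simp [hf.idem]
    | insert i s hi ih =>
      have hm : ∀ (p : Prop) [Decidable p], (if p then a else b) ∈ C := by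
        intro p _
        split_ifs
        exacts [ha, hb]
      exact (hindep i _ _ (fun _ => hm _) (fun _ => hm _) fun j hj => by simp [hj]).trans ih
  have := hall Finset.univ
  simp only [Finset.mem_univ, if_true, hf.idem] at this
  exact hab this

end CyclicInitial

lemma hasEGP_of_forall_not_isSource [Finite V] [Nonempty V] (hH : H.IsSemicomplete)
    (hs : ∀ s, ¬ H.IsSource s) (h : ¬ H.HasAtMostOneCycle) : HasEGP H.idPol := by
  obtain ⟨C, hC⟩ := exists_isInitial hH hs
  refine hasEGP_of_proj hH hC.exists_mem_adj fun k f hf => ?_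
  by_cases ht : (H.restrict C).HasTransitiveTriple
  · obtain ⟨i, hi⟩ := (hf.restrict fun x hx => hC.apply_mem hH hf hx).exists_eq_proj
      (hH.restrict C) hC.strong ht
    exact ⟨i, fun x hx => congrArg Subtype.val (hi fun j => ⟨x j, hx j⟩)⟩
  · exact exists_eq_proj_of_not_hasTransitiveTriple hH hC ht h hf

lemma idPol_op : H.op.idPol = H.idPol := by
  have : ∀ {G : Digraph V} {k : ℕ} {f : (Fin k → V) → V}, f ∈ G.idPol k → f ∈ G.op.idPol k :=
    fun h => ⟨h.1, fun x y hxy => h.2.1 y x hxy, h.2.2⟩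
  funext k
  exact Set.Subset.antisymm (fun _ h => this h) fun _ h => this h

lemma hasEGP [Finite V] (hH : H.IsSemicomplete) (h : ¬ H.HasAtMostOneCycle)
    (hst : ¬ ((∃ s, H.IsSource s) ∧ ∃ t, H.IsSink t)) : HasEGP H.idPol := by
  have : Nonempty V := by
    by_contra hV
    refine h fun D _ hD _ => ?_
    obtain ⟨n, c, -⟩ := hD
    exact absurd ⟨c 0⟩ hV
  by_cases hs : ∃ s, H.IsSource s
  · rw [← idPol_op]
    exact hasEGP_of_forall_not_isSource hH.op (fun t ht => hst ⟨hs, t, ht⟩)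
      fun h' => h (h'.op hH.op)
  · exact hasEGP_of_forall_not_isSource hH (fun s hs' => hs ⟨s, hs'⟩) h

/-! ### Polynomial growth -/

lemma hasPGP_of_growth_le {A : Type*} {F : Operations A} (K : ℕ) (h : ∀ m, growth F m ≤ m + K) :
    HasPGP F := by
  refine ⟨Polynomial.X + Polynomial.C (K : ℝ), IsBigO.of_bound 1 (Eventually.of_forall fun m => ?_)⟩
  have h' : (growth F m : ℝ) ≤ m + K := by exact_mod_cast h m
  have h0 : (0 : ℝ) ≤ m + K := by positivity
  simpa [abs_of_nonneg h0] using h'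

/-- A family of `m`-tuples generates the `m`-th power as soon as every `m`-tuple is the
coordinatewise image of the family under some idempotent polymorphism. -/
lemma growth_le_card {ι : Type*} [Fintype ι] [Nonempty ι] {m : ℕ} (t : ι → Fin m → V)
    (h : ∀ v : Fin m → V, ∃ f : (ι → V) → V, H.IsPol f ∧ ∀ j, f (fun i => t i j) = v j) :
    growth H.idPol m ≤ Fintype.card ι := by
  classical
  have hgen : Generates H.idPol m ((Finset.univ.image t : Finset _) : Set (Fin m → V)) := by
    refine fun S hS ht => Set.eq_univ_of_forall fun v => ?_
    obtain ⟨f, hf, hfv⟩ := h v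
    set e := Fintype.equivFin ι
    have := hS (Fintype.card ι) (fun x => f fun i => x (e i))
      ⟨Fintype.card_pos, fun x y hxy => hf.map fun i => hxy (e i), hf.idem⟩
      (fun i => t (e.symm i)) fun i => ht (by simp)
    simp only [Equiv.symm_apply_apply, hfv] at this
    exact this
  exact le_trans (Nat.sInf_le ⟨Finset.univ.image t, rfl, hgen⟩) Finset.card_image_le

/-- With a source `s` and a sink `t`, a tuple in which both occur is neither the tail nor the head
of an arc of a power of `H`, so that the value of a polymorphism at it is arbitrary. -/
lemma hasPGP_of_source_of_sink (hH : H.IsSemicomplete) {s t : V} (hs : H.IsSource s)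
    (ht : H.IsSink t) : HasPGP H.idPol := by
  classical
  by_cases hst : s = t
  · subst hst
    have hsub : ∀ v, v = s := fun v => by_contra fun hv => (hH.2 v s hv).elim (hs v) (ht v)
    refine hasPGP_of_growth_le 1 fun m => (growth_le_card (ι := Unit) (fun _ _ => s) fun v =>
      ⟨fun x => x (), ⟨fun h => h (), fun _ => rfl⟩, fun j => (hsub _).symm⟩).trans (by simp)
  refine hasPGP_of_growth_le 2 fun m => (growth_le_card (ι := Fin m ⊕ Bool)
    (fun i j => i.elim (fun i => if i = j then t else s) fun b => if b then t else s)
    fun v => ?_).trans (by simp)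
  set x : Fin m → Fin m ⊕ Bool → V := fun j i =>
    i.elim (fun i => if i = j then t else s) fun b => if b then t else s
  have hinj : ∀ j j', x j = x j' → j = j' := by
    intro j j' h
    by_contra hne
    have := congrFun h (.inl j)
    simp only [x, Sum.elim_inl, if_true, hne, if_false] at this
    exact hst this.symm
  refine ⟨fun y => if h : ∃ j, x j = y then v h.choose else y (.inr false), ⟨?_, ?_⟩, ?_⟩
  · intro y z hyz
    have hy : ¬ ∃ j, x j = y := by
      rintro ⟨j, rfl⟩
      exact ht _ (hyz (.inr true))
    have hz : ¬ ∃ j, x j = z := by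
      rintro ⟨j, rfl⟩
      exact hs _ (hyz (.inr false))
    simpa only [hy, hz, dif_neg, not_false_eq_true] using hyz _
  · intro w
    have hw : ¬ ∃ j, x j = fun _ => w := by
      rintro ⟨j, hj⟩
      exact hst ((congrFun hj (.inr false)).trans (congrFun hj (.inr true)).symm)
    simp only [hw, dif_neg, not_false_eq_true]
  · intro j
    have hj : ∃ j', x j' = x j := ⟨j, rfl⟩
    exact (dif_pos hj).trans (congrArg v (hinj _ _ hj.choose_spec))

/-- If the digraph is acyclic outside of its initial component `C`, choosing an argument of maximal
height outside of `C` is a polymorphism. -/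
lemma IsInitial.exists_isPol_notMem (hH : H.IsSemicomplete) {C : Set V} (hC : H.IsInitial C)
    {rank : V → ℕ} (hrank : ∀ a b, a ∉ C → H.Adj a b → rank a < rank b) {ι : Type*} [Finite ι]
    [Nonempty ι] : ∃ D : (ι → V) → V, H.IsPol D ∧ ∀ y, (∃ p, y p ∉ C) → D y ∉ C := by
  have hex : ∀ y : ι → V, ∃ w, (∃ p, w = y p) ∧
      ((∃ p, y p ∉ C) → w ∉ C ∧ ∀ q, y q ∉ C → rank (y q) ≤ rank w) ∧
      ((∀ p, y p ∈ C) → w = y (Classical.arbitrary ι)) := by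
    intro y
    by_cases hy : ∃ p, y p ∉ C
    · obtain ⟨p, hp, hmax⟩ := Set.exists_max_image {p | y p ∉ C} (fun p => rank (y p))
        (Set.toFinite _) hy
      exact ⟨y p, ⟨p, rfl⟩, fun _ => ⟨hp, hmax⟩, fun h => absurd (h p) hp⟩
    · exact ⟨_, ⟨_, rfl⟩, fun h => absurd h hy, fun _ => rfl⟩
  choose D hDmem hDout hDin using hex
  refine ⟨D, ⟨fun {y z} hyz => ?_, fun w => ?_⟩, fun y hy => (hDout y hy).1⟩
  · have hstep : ∀ p, y p ∉ C → z p ∉ C := fun p hp hz => hC.not_adj hz hp (hyz p)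
    by_cases hy : ∃ p, y p ∉ C
    · have hz := hDout z (hy.imp hstep)
      obtain ⟨p, hp⟩ := hDmem y
      have hpC : y p ∉ C := hp ▸ (hDout y hy).1
      have hlt : rank (D y) < rank (D z) :=
        hp ▸ (hrank _ _ hpC (hyz p)).trans_le (hz.2 p (hstep p hpC))
      by_contra hno
      have hne : D y ≠ D z := fun h => by simp [h] at hlt
      exact hlt.not_gt (hrank _ _ hz.1 (hH.adj_of_not hne hno))
    · push Not at hy
      rw [hDin y hy]
      by_cases hz : ∃ p, z p ∉ C
      · exact hC.adj (hy _) (hDout z hz).1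
      · push Not at hz
        rw [hDin z hz]
        exact hyz _
  · obtain ⟨p, hp⟩ := hDmem fun _ => w
    exact hp

/-! ### Generating tuples for an initial component that is a cycle -/

section CyclicInitial

variable {C : Set V} {m : ℕ}

/-- The tuples of the orbit of the `j`-th column: on the coordinates indexed by `C` they are an
endomorphism of the cycle `C`, and the position of `j` is marked by a successor. -/
structure InOrbit (H : Digraph V) (ρ : C → C) (c₀ : C) (j : Fin m) (y : Fin m ⊕ Option C → V) :
    Prop where
  mem : ∀ c, y (.inr (some c)) ∈ C
  adj : ∀ c, H.Adj (y (.inr (some c))) (y (.inr (some (ρ c))))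
  mark : y (.inl j) = y (.inr (some (ρ c₀)))
  unmarked : ∀ i, i ≠ j → y (.inl i) = y (.inr (some c₀))

namespace InOrbit

variable {ρ : C → C} {c₀ : C} {j : Fin m} {y z : Fin m ⊕ Option C → V}

lemma unique (hH : H.IsSemicomplete) {j' : Fin m} (h : H.InOrbit ρ c₀ j y)
    (h' : H.InOrbit ρ c₀ j' y) : j = j' := by
  by_contra hne
  have := h.adj c₀
  rw [← h.mark, h'.unmarked j hne] at this
  exact hH.1 _ this

/-- Orbits are closed under arcs to tuples in `C`. -/
lemma of_adj (hH : H.IsSemicomplete) (ht : ¬ (H.restrict C).HasTransitiveTriple)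
    (h : H.InOrbit ρ c₀ j y) (hyz : ∀ p, H.Adj (y p) (z p)) (hl : ∀ i, z (.inl i) ∈ C)
    (hr : ∀ c, z (.inr (some c)) ∈ C) : H.InOrbit ρ c₀ j z where
  mem := hr
  adj c := by
    have := eq_of_adj_of_adj hH ht (h.mem c) (hr c) (h.mem (ρ c)) (hyz _) (h.adj c)
    rw [this]
    exact hyz _
  mark := by
    have := hyz (.inl j)
    rw [h.mark] at this
    exact eq_of_adj_of_adj hH ht (h.mem _) (hl j) (hr _) this (hyz _)
  unmarked i hi := by
    have := hyz (.inl i)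
    rw [h.unmarked i hi] at this
    exact eq_of_adj_of_adj hH ht (h.mem _) (hl i) (hr _) this (hyz _)

lemma of_adj' (hH : H.IsSemicomplete) (hC : H.IsInitial C)
    (ht : ¬ (H.restrict C).HasTransitiveTriple) (h : H.InOrbit ρ c₀ j z)
    (hyz : ∀ p, H.Adj (y p) (z p)) : H.InOrbit ρ c₀ j y where
  mem c := hC.mem_of_reflTransGen (.single (hyz _)) (h.mem c)
  adj c := by
    have hm : ∀ c, y (.inr (some c)) ∈ C := fun c =>
      hC.mem_of_reflTransGen (.single (hyz _)) (h.mem c)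
    have := eq_of_adj_of_adj' hH ht (h.mem (ρ c)) (hm (ρ c)) (h.mem c) (hyz _) (h.adj c)
    rw [this]
    exact hyz _
  mark := by
    have := hyz (.inl j)
    rw [h.mark] at this
    exact eq_of_adj_of_adj' hH ht (h.mem _) (hC.mem_of_reflTransGen (.single this) (h.mem _))
      (hC.mem_of_reflTransGen (.single (hyz _)) (h.mem _)) this (hyz _)
  unmarked i hi := by
    have := hyz (.inl i)
    rw [h.unmarked i hi] at this
    exact eq_of_adj_of_adj' hH ht (h.mem _) (hC.mem_of_reflTransGen (.single this) (h.mem _))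
      (hC.mem_of_reflTransGen (.single (hyz _)) (h.mem _)) this (hyz _)

end InOrbit

/-- The columns of the generating family: the last coordinate holds the vertex `t`. -/
def column (ρ : C → C) (c₀ : C) (t : V) (j : Fin m) : Fin m ⊕ Option C → V
  | .inl i => open Classical in if i = j then ρ c₀ else c₀
  | .inr (some c) => c
  | .inr none => t

lemma inOrbit_column {ρ : C → C} (hρ : ∀ c : C, H.Adj c (ρ c)) (c₀ : C) (t : V) (j : Fin m) :
    H.InOrbit ρ c₀ j (column ρ c₀ t j) :=
  ⟨fun c => c.2, hρ, by simp [column], fun i hi => by simp [column, hi]⟩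

/-- On the orbit of the `j`-th column the polymorphism reads off `v j` if this is in `C`. If it is
not, there is a sink `t`, and tuples with a coordinate equal to `t` have no out-neighbours; so the
value `v j`, which is dominated by all of `C`, is admissible there. -/
lemma exists_isPol_column [Finite V] (hH : H.IsSemicomplete) (hC : H.IsInitial C)
    (ht : ¬ (H.restrict C).HasTransitiveTriple)
    {rank : V → ℕ} (hrank : ∀ a b, a ∉ C → H.Adj a b → rank a < rank b)
    {ρ : C → C} (hρ : ∀ c : C, H.Adj c (ρ c)) (c₀ : C) {t : V}
    (hsink : ∀ v ∉ C, H.IsSink t) (v : Fin m → V) :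
    ∃ f : (Fin m ⊕ Option C → V) → V, H.IsPol f ∧ ∀ j, f (column ρ c₀ t j) = v j := by
  classical
  obtain ⟨D, hD, hDout⟩ := hC.exists_isPol_notMem hH hrank (ι := Fin m ⊕ Option C)
  set g : Fin m → (Fin m ⊕ Option C → V) → V := fun j y =>
    if hj : v j ∈ C then y (.inr (some ⟨v j, hj⟩))
    else if y (.inr none) = t then v j else y (.inr (some c₀)) with hg
  set f : (Fin m ⊕ Option C → V) → V := fun y =>
    if h : ∃ j, H.InOrbit ρ c₀ j y then g h.choose y else D y with hf
  have hfg : ∀ {j y}, H.InOrbit ρ c₀ j y → f y = g j y := by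
    intro j y h
    have hex : ∃ j, H.InOrbit ρ c₀ j y := ⟨j, h⟩
    simp only [hf, dif_pos hex, InOrbit.unique hH hex.choose_spec h]
  have hfD : ∀ {y}, (¬ ∃ j, H.InOrbit ρ c₀ j y) → f y = D y := fun h => dif_neg h
  -- at the tail of an arc, `g j` takes a value in `C`
  have htail : ∀ {j} {y z : Fin m ⊕ Option C → V}, H.InOrbit ρ c₀ j y → (∀ p, H.Adj (y p) (z p)) →
      g j y = y (.inr (some (if hj : v j ∈ C then ⟨v j, hj⟩ else c₀))) := by
    intro j y z hy hyz
    by_cases hj : v j ∈ C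
    · simp [hg, hj]
    · have : y (.inr none) ≠ t := fun h => hsink _ hj _ (h ▸ hyz (.inr none))
      simp [hg, hj, this]
  refine ⟨f, ⟨fun {y z} hyz => ?_, fun w => ?_⟩, fun j => ?_⟩
  · by_cases hz : ∃ j, H.InOrbit ρ c₀ j z
    · obtain ⟨j, hz⟩ := hz
      have hy := hz.of_adj' hH hC ht hyz
      rw [hfg hz, hfg hy, htail hy hyz]
      by_cases hj : v j ∈ C
      · simpa [hg, hj] using hyz _
      · simp only [hg, hj, dif_neg, not_false_eq_true]
        split_ifs
        · exact hC.adj (hy.mem _) hj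
        · exact hyz _
    · rw [hfD hz]
      by_cases hy : ∃ j, H.InOrbit ρ c₀ j y
      · obtain ⟨j, hy⟩ := hy
        rw [hfg hy, htail hy hyz]
        refine hC.adj (hy.mem _) (hDout z ?_)
        by_contra! hall
        exact hz ⟨j, hy.of_adj hH ht hyz (fun _ => hall _) fun _ => hall _⟩
      · rw [hfD hy]
        exact hD.map hyz
  · rw [hfD, hD.idem]
    rintro ⟨j, h⟩
    exact hH.1 _ (h.adj c₀)
  · rw [hfg (inOrbit_column hρ c₀ t j)]
    by_cases hj : v j ∈ C <;> simp [hg, hj, column]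

end CyclicInitial

lemma hasPGP_of_forall_not_isSource [Finite V] [Nonempty V] (hH : H.IsSemicomplete)
    (hs : ∀ s, ¬ H.IsSource s) (h : H.HasAtMostOneCycle) : HasPGP H.idPol := by
  have := Fintype.ofFinite V
  obtain ⟨C, hC⟩ := exists_isInitial hH hs
  obtain ⟨h1, h2⟩ := hasAtMostOneCycle_iff.1 h
  have harc : ∀ {a b}, a ∈ C → b ∈ C → H.Adj a b → H.CycleArc a b := fun ha hb hab =>
    ⟨hab, (hC.strong ⟨_, hb⟩ ⟨_, ha⟩).lift Subtype.val fun _ _ h => h⟩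
  have ht : ¬ (H.restrict C).HasTransitiveTriple := by
    rintro ⟨x, y, z, hxy, hxz, hzy⟩
    have := h1 _ _ _ (harc x.2 y.2 hxy) (harc x.2 z.2 hxz)
    exact hH.ne_of_adj hzy this.symm
  choose ρ hρC hρ using fun c : C => exists_adj_mem hC.strong hC.nontrivial c.2
  obtain ⟨c₀, hc₀⟩ := hC.nontrivial.nonempty
  set rank : V → ℕ := fun v => {u | Relation.ReflTransGen H.Adj u v}.ncard
  have hrank : ∀ a b, a ∉ C → H.Adj a b → rank a < rank b := by
    intro a b ha hab
    by_contra hle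
    have hba := reflTransGen_of_ncard_le (.single hab) (not_lt.1 hle)
    exact ha (hC.mem_of_reflTransGen
      (h2 _ _ _ _ ⟨hab, hba⟩ (harc hc₀ (hρC ⟨c₀, hc₀⟩) (hρ ⟨c₀, hc₀⟩))) hc₀)
  have hsink : ∃ t, ∀ v ∉ C, H.IsSink t := by
    by_cases hne : {v | v ∉ C}.Nonempty
    · obtain ⟨t, htC, hmax⟩ := Set.exists_max_image _ rank (Set.toFinite _) hne
      refine ⟨t, fun _ _ u hu => (hrank t u htC hu).not_ge (hmax u fun huC => ?_)⟩
      exact hC.not_adj huC htC hu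
    · exact ⟨c₀, fun v hv => absurd ⟨v, hv⟩ hne⟩
  obtain ⟨t, ht'⟩ := hsink
  have := Fintype.ofFinite C
  refine hasPGP_of_growth_le (Fintype.card C + 1) fun m =>
    (growth_le_card (fun i j => column (fun c => ⟨ρ c, hρC c⟩) ⟨c₀, hc₀⟩ t j i) fun v => ?_).trans
      (by simp)
  exact exists_isPol_column hH hC ht hrank hρ ⟨c₀, hc₀⟩ ht' v

lemma hasPGP_of_hasAtMostOneCycle [Finite V] (hH : H.IsSemicomplete) (h : H.HasAtMostOneCycle) :
    HasPGP H.idPol := by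
  rcases isEmpty_or_nonempty V with hV | hV
  · refine hasPGP_of_growth_le 1 fun m => ?_
    have hsub : Subsingleton (Fin m → V) := ⟨fun x y => funext fun j => hV.elim (x j)⟩
    obtain ⟨Γ, hcard, -⟩ := Nat.sInf_mem (growth_set_nonempty H.idPol m)
    have h1 := Finset.card_le_one_of_subsingleton Γ
    rw [hcard] at h1
    exact le_add_left h1
  by_cases hs : ∃ s, H.IsSource s
  · by_cases ht : ∃ t, H.IsSink t
    · exact hasPGP_of_source_of_sink hH hs.choose_spec ht.choose_spec
    · rw [← idPol_op]
      exact hasPGP_of_forall_not_isSource hH.op (fun t h => ht ⟨t, h⟩) (h.op hH)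
  · exact hasPGP_of_forall_not_isSource hH (fun s h => hs ⟨s, h⟩) h

end Digraph

theorem mainTheorem2 {V : Type*} [Finite V] (H : Digraph V) (hH : H.IsSemicomplete) :
    ((H.HasAtMostOneCycle ∨ ((∃ s, H.IsSource s) ∧ (∃ t, H.IsSink t))) → HasPGP H.idPol) ∧
    (¬ (H.HasAtMostOneCycle ∨ ((∃ s, H.IsSource s) ∧ (∃ t, H.IsSink t))) → HasEGP H.idPol) := by
  refine ⟨?_, fun h => Digraph.hasEGP hH (fun h' => h (.inl h')) fun h' => h (.inr h')⟩
  rintro (h | ⟨⟨s, hs⟩, t, ht⟩)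
  · exact Digraph.hasPGP_of_hasAtMostOneCycle hH h
  · exact Digraph.hasPGP_of_source_of_sink hH hs ht
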